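/- Let $(k,\partial)$ be an ordinary differential field of characteristic $0$ whose field of constants $C_k=\{c\in k : c'=0\}$ is algebraically closed, and let $k[\partial]$ be the ring of differential operators $\sum_i a_i\partial^i$, $a_i\in k$, with multiplication determined by $\partial a=a\partial+a'$. Let $0\neq L\in k[\partial]$ have order $n$, and let $A_L\in\mathrm{gl}_n(k)$ be the companion matrix of the equation $L(y)=0$ (after division by the leading coefficient of $L$). Let $K$ be a Picard–Vessiot field for $L(y)=0$, i.e. the quotient field (as a differential $k$-algebra) of a Picard–Vessiot ring $R$ for $Y'=A_LY$: $R$ is a simple differential ring over $k$ that is generated as a ring by $k$, the entries of some $Z\in\mathrm{GL}_n(R)$ with $Z'=A_LZ$, and $1/\det Z$. Let $G$ be the group of $k$-automorphisms of $K$ that commute with the derivation, and for $P\in k[\partial]$ put $\mathrm{Soln}_K(P)=\{y\in K : P(y)=0\}$, a $C_k$-vector space; let $V=\mathrm{Soln}_K(L)$. Then the following three families are in bijective correspondence: 1. monic $L_0\in k[\partial]$ such that $L=L_1L_0$ for some $L_1\in k[\partial]$; 2. differential submodules (that is, left $k[\partial]$-submodules) of $k[\partial]/k[\partial]L$; 3.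 $G$-invariant $C_k$-subspaces of $V$. More precisely: (a) $L_0\mapsto k[\partial]L_0/k[\partial]L$ is a bijection from family 1 to family 2. (b) $L_0\mapsto \mathrm{Soln}_K(L_0)$ is a bijection from family 1 to family 3, and $\dim_{C_k}\mathrm{Soln}_K(L_0)$ equals the order of $L_0$. (c) Let $W\subset V$ be a $G$-invariant subspace with $C_k$-basis $b_1,\dots,b_t$. Then the Wronskian $wr(b_1,\dots,b_t)=\det\big(b_j^{(i-1)}\big)_{1\le i,j\le t}$ is nonzero, the coefficients of the operator $$L_W(Y)=\frac{wr(b_1,\dots,b_t,Y)}{wr(b_1,\dots,b_t)}\in K[\partial]$$ are fixed by $G$ and lie in $k$, and $L_W$, regarded as an element of $k[\partial]$, is a monic right factor of $L$ with $\mathrm{Soln}_K(L_W)=W$. -/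

import Mathlib

open Polynomial Differential

/-- The ring `k[∂]` of linear differential operators over a differential ring `k`. As an additive
group it is the group of polynomials `∑ aᵢ ∂ⁱ` with coefficients written on the left, the
polynomial variable standing for `∂`; its (noncommutative) multiplication is defined below. -/
def DiffOp (k : Type*) [CommRing k] : Type _ := k[X]

namespace DiffOp

section Ring

variable {k : Type*} [CommRing k]

noncomputable instance instAddCommGroup : AddCommGroup (DiffOp k) :=
  inferInstanceAs (AddCommGroup k[X])

/-- The operator `∑ aᵢ ∂ⁱ` with the coefficients of a given polynomial `∑ aᵢ Xⁱ`. -/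
noncomputable def ofPoly : k[X] ≃+ DiffOp k := AddEquiv.refl _

/-- The polynomial `∑ aᵢ Xⁱ` of coefficients of an operator `∑ aᵢ ∂ⁱ`. -/
noncomputable def toPoly : DiffOp k ≃+ k[X] := AddEquiv.refl _

/-- The coefficient of `∂ⁱ`. -/
noncomputable def coeff (L : DiffOp k) (i : ℕ) : k := (toPoly L).coeff i

/-- The order of an operator (`0` for the zero operator). -/
noncomputable def ord (L : DiffOp k) : ℕ := (toPoly L).natDegree

/-- An operator is monic if its leading coefficient is `1`. -/
def Monic (L : DiffOp k) : Prop := (toPoly L).Monic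

variable [Differential k]

/-- Left multiplication by `∂`:  `∂ · ∑ aᵢ ∂ⁱ = ∑ aᵢ′ ∂ⁱ + ∑ aᵢ ∂ⁱ⁺¹`. -/
noncomputable def delMul : Module.End ℤ k[X] :=
  (Differential.mapCoeffs : Derivation ℤ k[X] k[X]).toLinearMap +
    LinearMap.mulLeft ℤ (X : k[X])

/-- Left multiplication by `∑ aᵢ ∂ⁱ`:  `(∑ aᵢ ∂ⁱ) · M = ∑ aᵢ (∂ⁱ · M)`. -/
noncomputable def leftMul (L : k[X]) : Module.End ℤ k[X] :=
  L.sum fun i a => LinearMap.mulLeft ℤ (C a) * delMul ^ i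

noncomputable instance instMul : Mul (DiffOp k) :=
  ⟨fun L M => ofPoly (leftMul (toPoly L) (toPoly M))⟩

noncomputable instance instOne : One (DiffOp k) := ⟨ofPoly 1⟩

theorem delMul_apply (p : k[X]) : delMul p = Differential.mapCoeffs p + X * p := rfl

theorem leftMul_monomial (i : ℕ) (a : k) :
    leftMul (monomial i a) = LinearMap.mulLeft ℤ (C a) * delMul ^ i := by
  apply sum_monomial_index
  ext1 p
  simp

theorem leftMul_add (L M : k[X]) : leftMul (L + M) = leftMul L + leftMul M := by
  apply sum_add_index
  · intro i
    ext1 p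
    simp
  · intro i a b
    ext1 p
    simp [add_mul]

theorem leftMul_delMul (M : k[X]) : leftMul (delMul M) = delMul * leftMul M := by
  induction M using Polynomial.induction_on' with
  | add p q hp hq => rw [map_add, leftMul_add, leftMul_add, hp, hq, mul_add]
  | monomial j b =>
    have h : delMul (monomial j b : k[X]) = monomial j (b′) + monomial (j + 1) b := by
      rw [delMul_apply, Differential.mapCoeffs_monomial, X_mul_monomial]
    rw [h, leftMul_add, leftMul_monomial, leftMul_monomial, leftMul_monomial]
    ext1 p
    simp only [LinearMap.add_apply, Module.End.mul_apply, LinearMap.mulLeft_apply,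
      pow_succ', delMul_apply, Derivation.leibniz, Differential.mapCoeffs_C, smul_eq_mul]
    ring

theorem leftMul_leftMul (L M : k[X]) : leftMul (leftMul L M) = leftMul L * leftMul M := by
  induction L using Polynomial.induction_on' with
  | add p q hp hq =>
    rw [leftMul_add, LinearMap.add_apply, leftMul_add, hp, hq, add_mul]
  | monomial i a =>
    have hC : ∀ P : k[X], leftMul (C a * P) = LinearMap.mulLeft ℤ (C a) * leftMul P := by
      intro P
      induction P using Polynomial.induction_on' with
      | add p q hp hq => rw [mul_add, leftMul_add, leftMul_add, hp, hq, mul_add]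
      | monomial j b =>
        rw [C_mul_monomial, leftMul_monomial, leftMul_monomial, ← mul_assoc]
        congr 1
        ext1 p
        simp
    have hT : ∀ (n : ℕ) (P : k[X]), leftMul ((delMul ^ n) P) = delMul ^ n * leftMul P := by
      intro n
      induction n with
      | zero => intro P; simp
      | succ n ih =>
        intro P
        rw [pow_succ', Module.End.mul_apply, leftMul_delMul, ih, mul_assoc]
    rw [leftMul_monomial, Module.End.mul_apply, LinearMap.mulLeft_apply, hC, hT, mul_assoc]

theorem leftMul_one : leftMul (1 : k[X]) = 1 := by
  rw [← monomial_zero_one, leftMul_monomial]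
  ext1 p
  simp

theorem leftMul_apply_one (L : k[X]) : leftMul L 1 = L := by
  have hT : ∀ n : ℕ, (delMul ^ n) (1 : k[X]) = X ^ n := by
    intro n
    induction n with
    | zero => simp
    | succ n ih =>
      rw [pow_succ', Module.End.mul_apply, ih, delMul_apply]
      have : Differential.mapCoeffs (X ^ n : k[X]) = 0 := by
        rw [← monomial_one_right_eq_X_pow, Differential.mapCoeffs_monomial]
        simp
      rw [this, zero_add, pow_succ']
  induction L using Polynomial.induction_on' with
  | add p q hp hq => rw [leftMul_add, LinearMap.add_apply, hp, hq]
  | monomial i a =>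
    rw [leftMul_monomial, Module.End.mul_apply, hT, LinearMap.mulLeft_apply,
      C_mul_X_pow_eq_monomial]

noncomputable instance instRing : Ring (DiffOp k) :=
  { instAddCommGroup, instMul, instOne with
    left_distrib := fun L M N => (leftMul (toPoly L)).map_add _ _
    right_distrib := fun L M N => DFunLike.congr_fun (leftMul_add (toPoly L) (toPoly M)) (toPoly N)
    zero_mul := fun M => by
      change leftMul (0 : k[X]) (toPoly M) = (0 : k[X])
      simp [leftMul]
    mul_zero := fun L => (leftMul (toPoly L)).map_zero
    mul_assoc := fun L M N =>
      DFunLike.congr_fun (leftMul_leftMul (toPoly L) (toPoly M)) (toPoly N)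
    one_mul := fun M => DFunLike.congr_fun leftMul_one (toPoly M)
    mul_one := fun L => leftMul_apply_one (toPoly L)
    zsmul := instAddCommGroup.zsmul
    neg_add_cancel := instAddCommGroup.neg_add_cancel }

/-- The operator `∂`. -/
noncomputable def del : DiffOp k := ofPoly X

/-- The operator of order zero given by `a ∈ k`. -/
noncomputable def const (a : k) : DiffOp k := ofPoly (C a)

/-- The defining relation `∂ · a = a ∂ + a′` of `k[∂]`. -/
theorem del_mul_const (a : k) : del * const a = const a * del + const (a′) := by
  change leftMul X (C a) = leftMul (C a) X + C (a′)
  have hX : leftMul (X : k[X]) = LinearMap.mulLeft ℤ (C 1) * delMul ^ 1 := by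
    rw [← monomial_one_one_eq_X, leftMul_monomial]
  have hC : leftMul (C a) = LinearMap.mulLeft ℤ (C a) * delMul ^ 0 := by
    rw [← monomial_zero_left, leftMul_monomial, monomial_zero_left]
  rw [hX, hC]
  simp only [Module.End.mul_apply, pow_one, pow_zero, LinearMap.mulLeft_apply, delMul_apply,
    Differential.mapCoeffs_C, Module.End.one_apply, C_1, one_mul]
  ring

/-- The monomial with coefficient `a` in degree `i` is the product `a ∂ⁱ` in `k[∂]`. -/
theorem const_mul_del_pow (a : k) (i : ℕ) : const a * del ^ i = ofPoly (monomial i a) := by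
  have hd : ∀ n : ℕ, (del : DiffOp k) ^ n = ofPoly ((delMul ^ n) 1) := by
    intro n
    induction n with
    | zero => rfl
    | succ n ih =>
      rw [pow_succ', ih, pow_succ', Module.End.mul_apply]
      change leftMul X ((delMul ^ n) 1) = delMul ((delMul ^ n) 1)
      rw [← monomial_one_one_eq_X, leftMul_monomial]
      simp
  rw [hd]
  change leftMul (C a) ((delMul ^ i) 1) = monomial i a
  have h := leftMul_apply_one (monomial i a)
  rw [leftMul_monomial, Module.End.mul_apply] at h
  rw [← monomial_zero_left, leftMul_monomial]
  simpa using h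

end Ring

section Solutions

variable {k : Type*} [Field k] [Differential k]

/-- The value `L(y) = ∑ aᵢ y⁽ⁱ⁾` of an operator `L = ∑ aᵢ ∂ⁱ ∈ k[∂]` at an element `y` of a
differential ring extension of `k`. -/
noncomputable def eval {K : Type*} [CommRing K] [Differential K] [Algebra k K]
    (L : DiffOp k) (y : K) : K :=
  (toPoly L).sum fun i a => algebraMap k K a * (fun z : K => z′)^[i] y

/-- The operator over `K` with the same coefficients as a given operator over `k`. -/
noncomputable def map {k : Type*} [CommRing k] (K : Type*) [CommRing K] [Algebra k K]
    (L : DiffOp k) : DiffOp K :=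
  ofPoly ((toPoly L).map (algebraMap k K))

/-- The companion matrix `A_L`: the equation `L(y) = 0` is equivalent to `Y' = A_L Y`
for `Y = (y, y′, …, y⁽ⁿ⁻¹⁾)ᵗ`. The operator `L` is divided by its leading coefficient. -/
noncomputable def companion (L : DiffOp k) : Matrix (Fin L.ord) (Fin L.ord) k :=
  Matrix.of fun i j =>
    if (i : ℕ) + 1 = j then 1
    else if (i : ℕ) + 1 = L.ord then -(L.coeff j / L.coeff L.ord)
    else 0

end Solutions

end DiffOp

section PicardVessiot

/-- The field of constants of a differential field. -/
def fieldOfConstants (k : Type*) [Field k] [Differential k] : Subfield k where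
  carrier := {c | c′ = 0}
  mul_mem' := by
    intro a b (ha : a′ = 0) (hb : b′ = 0)
    simp [Derivation.leibniz, ha, hb]
  one_mem' := by simp
  add_mem' := by
    intro a b (ha : a′ = 0) (hb : b′ = 0)
    simp [ha, hb]
  zero_mem' := by simp
  neg_mem' := by
    intro a (ha : a′ = 0)
    simp [ha]
  inv_mem' := by
    intro a (ha : a′ = 0)
    simp [Derivation.leibniz_inv, ha]

/-- A simple differential ring: a nonzero differential ring whose only differential ideals
(ideals stable under the derivation) are `(0)` and the whole ring. -/
def IsSimpleDifferentialRing (R : Type*) [CommRing R] [Differential R] : Prop :=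
  Nontrivial R ∧ ∀ I : Ideal R, (∀ x ∈ I, x′ ∈ I) → I = ⊥ ∨ I = ⊤

/-- `Z ∈ GLₙ(R)` is a fundamental solution matrix of `Y' = AY`. -/
def IsFundamentalMatrix {k : Type*} [CommRing k] {n : ℕ} (A : Matrix (Fin n) (Fin n) k)
    {R : Type*} [CommRing R] [Differential R] [Algebra k R]
    (Z : Matrix.GeneralLinearGroup (Fin n) R) : Prop :=
  (Z : Matrix (Fin n) (Fin n) R).map (fun z => z′) =
    A.map (algebraMap k R) * (Z : Matrix (Fin n) (Fin n) R)

/-- `R` is a Picard-Vessiot ring over `k` for the equation `Y' = AY`: it is a simple differential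
ring, and it is generated over `k` by the entries and the inverse of the determinant of a
fundamental solution matrix. -/
def IsPVRing {k : Type*} [Field k] [Differential k] {n : ℕ} (A : Matrix (Fin n) (Fin n) k)
    (R : Type*) [CommRing R] [Differential R] [Algebra k R] [DifferentialAlgebra k R] : Prop :=
  IsSimpleDifferentialRing R ∧
    ∃ Z : Matrix.GeneralLinearGroup (Fin n) R, IsFundamentalMatrix A Z ∧
      Algebra.adjoin k ({r : R | ∃ i j, r = (Z : Matrix (Fin n) (Fin n) R) i j} ∪
        {((Matrix.GeneralLinearGroup.det Z)⁻¹ : Rˣ).val}) = ⊤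

/-- `K` is a Picard-Vessiot field over `k` for the equation `Y' = AY`: it is (as a differential
`k`-algebra) the quotient field of a Picard-Vessiot ring for this equation. -/
def IsPVField.{u, v} {k : Type u} [Field k] [Differential k] {n : ℕ}
    (A : Matrix (Fin n) (Fin n) k)
    (K : Type v) [Field K] [Differential K] [Algebra k K] [DifferentialAlgebra k K] : Prop :=
  ∃ (R : Type v) (_ : CommRing R) (_ : Differential R) (_ : Algebra k R)
    (_ : DifferentialAlgebra k R) (_ : Algebra R K) (_ : DifferentialAlgebra R K),
    IsScalarTower k R K ∧ IsFractionRing R K ∧ IsPVRing A R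

/-- The differential Galois group of `K` over `k`: the group of `k`-automorphisms of the field `K`
that commute with the derivation. -/
def DGal (k K : Type*) [Field k] [Field K] [Differential K] [Algebra k K] :
    Subgroup (K ≃ₐ[k] K) where
  carrier := {σ | ∀ x : K, σ (x′) = (σ x)′}
  mul_mem' := by
    intro σ τ (hσ : ∀ x : K, σ (x′) = (σ x)′) (hτ : ∀ x : K, τ (x′) = (τ x)′) x
    simp [hσ, hτ]
  one_mem' := fun x => rfl
  inv_mem' := by
    intro σ (hσ : ∀ x : K, σ (x′) = (σ x)′) x
    apply σ.injective
    rw [hσ, AlgEquiv.aut_inv, AlgEquiv.apply_symm_apply, AlgEquiv.apply_symm_apply]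

variable {k : Type*} [Field k] [Differential k]

theorem DiffOp.iterate_deriv_add {K : Type*} [CommRing K] [Differential K] (i : ℕ) (x y : K) :
    (fun z : K => z′)^[i] (x + y) = (fun z : K => z′)^[i] x + (fun z : K => z′)^[i] y := by
  induction i with
  | zero => rfl
  | succ i ih => simp only [Function.iterate_succ_apply', ih, map_add]

theorem DiffOp.iterate_deriv_smul {K : Type*} [Field K] [Differential K] [Algebra k K]
    [DifferentialAlgebra k K] (i : ℕ) (c : fieldOfConstants k) (y : K) :
    (fun z : K => z′)^[i] (c • y) = c • (fun z : K => z′)^[i] y := by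
  have hc : ((c : k))′ = 0 := c.2
  induction i with
  | zero => rfl
  | succ i ih =>
    simp only [Function.iterate_succ_apply', ih]
    rw [Subfield.smul_def, Subfield.smul_def, Algebra.smul_def, Algebra.smul_def,
      Derivation.leibniz, deriv_algebraMap, hc]
    simp

/-- The solution space of `L(y) = 0` in `K`, as a vector space over the constants of `k`. -/
noncomputable def DiffOp.solutionSpace (K : Type*) [Field K] [Differential K] [Algebra k K]
    [DifferentialAlgebra k K] (L : DiffOp k) : Submodule (fieldOfConstants k) K where
  carrier := {y | L.eval y = 0}
  zero_mem' := by
    have h : ∀ i : ℕ, (fun z : K => z′)^[i] 0 = 0 := by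
      intro i
      exact Function.iterate_fixed (map_zero _) i
    simp [DiffOp.eval, Polynomial.sum_def, h]
  add_mem' := by
    intro x y (hx : L.eval x = 0) (hy : L.eval y = 0)
    change L.eval (x + y) = 0
    rw [← add_zero (0 : K)]
    nth_rewrite 1 [← hx]
    rw [← hy]
    simp only [DiffOp.eval, Polynomial.sum_def, ← Finset.sum_add_distrib,
      DiffOp.iterate_deriv_add, mul_add]
  smul_mem' := by
    intro c y (hy : L.eval y = 0)
    change L.eval (c • y) = 0
    rw [← smul_zero c, ← hy]
    simp only [DiffOp.eval, Polynomial.sum_def, DiffOp.iterate_deriv_smul, Finset.smul_sum,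
      mul_smul_comm]

/-- The monic right factors of `L`: the monic `L₀ ∈ k[∂]` with `L = L₁ L₀` for some `L₁ ∈ k[∂]`. -/
def DiffOp.monicRightFactors (L : DiffOp k) : Set (DiffOp k) :=
  {L₀ | L₀.Monic ∧ ∃ L₁ : DiffOp k, L = L₁ * L₀}

/-- The subspaces of the solution space of `L(y) = 0` in `K` that are invariant under the
differential Galois group of `K` over `k`. -/
def DiffOp.invariantSubspaces (K : Type*) [Field K] [Differential K] [Algebra k K]
    [DifferentialAlgebra k K] (L : DiffOp k) : Set (Submodule (fieldOfConstants k) K) :=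
  {W | W ≤ L.solutionSpace K ∧ ∀ σ ∈ DGal k K, ∀ w ∈ W, σ w ∈ W}

/-- The Wronskian determinant `wr(b₁, …, b_t)`. -/
noncomputable def wronskianDet {K : Type*} [CommRing K] [Differential K] {t : ℕ}
    (b : Fin t → K) : K :=
  (Matrix.of fun i j : Fin t => (fun z : K => z′)^[(i : ℕ)] (b j)).det

/-- The operator `wr(b₁, …, b_t, Y) / wr(b₁, …, b_t)`, where `Y⁽ⁱ⁾` is replaced by `∂ⁱ`: the
determinant with columns `(b_j, b_j′, …, b_j⁽ᵗ⁾)` and `(1, ∂, …, ∂ᵗ)`, expanded along the last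
column with the coefficients on the left, and divided by `wr(b₁, …, b_t)`. -/
noncomputable def wronskianOperator {K : Type*} [Field K] [Differential K] {t : ℕ}
    (b : Fin t → K) : DiffOp K :=
  DiffOp.ofPoly (C (wronskianDet b)⁻¹ *
    (Matrix.of fun i : Fin (t + 1) =>
      Fin.snoc (α := fun _ => K[X]) (fun j : Fin t => C ((fun z : K => z′)^[(i : ℕ)] (b j)))
        (X ^ (i : ℕ))).det)

end PicardVessiot

/-! Right factors and submodules are matched by Euclid's algorithm: right division by monic
operators makes every nonzero left ideal of k[∂] principal with a unique monic generator, and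
submodules of k[∂]/k[∂]L are left ideals containing L.

The correspondence with invariant subspaces rests on three facts about K: it has no constants
outside C_k (`IsPVRing.constants_iff`), dim V is at least n (`DiffOp.ord_le_rank_solutionSpace`),
and the fixed field of G is k (`IsPVRing.mem_range_of_forall_mem_DGal`). The first bounds the
solution space of any nonzero operator over K by its order (`DiffOp.rank_ker_evalLinear_le`). If L =
L₁L₀, then n ≤ dim Soln(L₁) + dim Soln(L₀) forces equality in both bounds, so L₀ has a full solution
space and is determined by it. Conversely, for invariant W the Wronskian operator is the only monic
operator of order dim W killing W, so G fixes it and its coefficients lie in k. Dividing L by it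
leaves a remainder with too many solutions for its order, hence zero.

Both the first and the third fact come from `Ideal.IsMaximalDifferential.exists_sub_mem`: constants
of a finitely generated differential algebra modulo a maximal differential ideal come from the
algebraically closed constant field. Applied to the zero ideal of R over k it shows that K has no
new constants. For the fixed field, let a = b/c lie outside k. Then d = a⊗c − 1⊗b in K⊗R is not
nilpotent, so K⊗R with d inverted has a maximal differential ideal P. Modulo P the image of R lies
in K, because two fundamental matrices differ by a constant matrix. The resulting map R → K extends
to an element of G. If it fixed a, then d would lie in P, although d is a unit there. -/

namespace DiffOp

/-! ### Orders, leading coefficients and right division in k[∂] -/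

section Coefficients

variable {k : Type*} [CommRing k]

theorem coeff_ofPoly (p : k[X]) (i : ℕ) : (ofPoly p).coeff i = p.coeff i := rfl

theorem coeff_sub (L M : DiffOp k) (i : ℕ) : (L - M).coeff i = L.coeff i - M.coeff i :=
  Polynomial.coeff_sub (toPoly L) (toPoly M) i

theorem ext_coeff {L M : DiffOp k} (h : ∀ i, L.coeff i = M.coeff i) : L = M :=
  Polynomial.ext (p := toPoly L) (q := toPoly M) h

theorem coeff_eq_zero_of_ord_lt {L : DiffOp k} {i : ℕ} (h : L.ord < i) : L.coeff i = 0 :=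
  Polynomial.coeff_eq_zero_of_natDegree_lt h

theorem coeff_ord_ne_zero {L : DiffOp k} (hL : L ≠ 0) : L.coeff L.ord ≠ 0 :=
  (Polynomial.leadingCoeff_ne_zero (p := toPoly L)).mpr hL

theorem ord_lt_of_coeff {L : DiffOp k} {n : ℕ} (hL : L ≠ 0) (h : ∀ i, n ≤ i → L.coeff i = 0) :
    L.ord < n := by
  by_contra! hn
  exact coeff_ord_ne_zero hL (h _ hn)

theorem Monic.coeff_ord {L : DiffOp k} (hL : L.Monic) : L.coeff L.ord = 1 := hL

theorem Monic.ne_zero [Nontrivial k] {L : DiffOp k} (hL : L.Monic) : L ≠ 0 :=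
  Polynomial.Monic.ne_zero (p := toPoly L) hL

theorem ord_eq_of_coeff {L : DiffOp k} {n : ℕ} (h : ∀ i, n < i → L.coeff i = 0)
    (hn : L.coeff n ≠ 0) : L.ord = n :=
  Polynomial.natDegree_eq_of_le_of_coeff_ne_zero
    (Polynomial.natDegree_le_iff_coeff_eq_zero.mpr h) hn

theorem Monic.coeff_sub_eq_zero {L M : DiffOp k} (hL : L.Monic) (hM : M.Monic)
    (h : L.ord = M.ord) {i : ℕ} (hi : M.ord ≤ i) : (L - M).coeff i = 0 := by
  rw [coeff_sub]
  rcases hi.eq_or_lt with rfl | hi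
  · rw [hM.coeff_ord, ← h, hL.coeff_ord, sub_self]
  · rw [coeff_eq_zero_of_ord_lt hi, coeff_eq_zero_of_ord_lt (h ▸ hi), sub_zero]

variable [Differential k]

/-- In p′ + Xp only the second term reaches the new top degree, so the top coefficient is passed on
undifferentiated. Working with a bound m instead of the exact degree spares a case distinction for
zero. -/
theorem natDegree_delMul_pow_le {p : k[X]} {m : ℕ} (hp : p.natDegree ≤ m) (i : ℕ) :
    ((delMul ^ i) p).natDegree ≤ i + m ∧ ((delMul ^ i) p).coeff (i + m) = p.coeff m := by
  induction i with
  | zero => simpa using hp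
  | succ i ih =>
    rw [pow_succ', Module.End.mul_apply, delMul_apply, natDegree_le_iff_coeff_eq_zero]
    have h0 := natDegree_le_iff_coeff_eq_zero.mp ih.1
    constructor
    · intro N hN
      obtain ⟨N, rfl⟩ := Nat.exists_eq_succ_of_ne_zero (show N ≠ 0 by omega)
      simp [coeff_X_mul, h0 N (by omega), h0 (N + 1) (by omega)]
    · rw [show i + 1 + m = (i + m) + 1 by omega, Polynomial.coeff_add, coeff_X_mul,
        Differential.coeff_mapCoeffs, h0 _ (Nat.lt_succ_self _), ih.2, map_zero, zero_add]

theorem leftMul_apply_eq_sum {L : k[X]} {l : ℕ} (hL : L.natDegree ≤ l) (M : k[X]) :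
    leftMul L M = ∑ i ∈ Finset.range (l + 1), C (L.coeff i) * (delMul ^ i) M := by
  rw [leftMul, sum_over_range' _ (by intro i; ext1 p; simp) (l + 1) (Nat.lt_succ_of_le hL)]
  simp [LinearMap.sum_apply]

theorem coeff_mul_of_ord_le {L M : DiffOp k} {l m : ℕ} (hL : L.ord ≤ l) (hM : M.ord ≤ m) :
    (L * M).ord ≤ l + m ∧ (L * M).coeff (l + m) = L.coeff l * M.coeff m := by
  change (leftMul (toPoly L) (toPoly M)).natDegree ≤ l + m ∧
    (leftMul (toPoly L) (toPoly M)).coeff (l + m) = (toPoly L).coeff l * (toPoly M).coeff m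
  have hd := fun i => natDegree_delMul_pow_le (p := toPoly M) hM i
  rw [leftMul_apply_eq_sum (L := toPoly L) hL]
  constructor
  · refine natDegree_sum_le_of_forall_le _ _ fun i hi => ?_
    refine (natDegree_C_mul_le _ _).trans ((hd i).1.trans ?_)
    have := Finset.mem_range.mp hi
    omega
  · rw [finsetSum_coeff, Finset.sum_range_succ, Finset.sum_eq_zero, zero_add, coeff_C_mul,
      (hd l).2]
    intro i hi
    have := Finset.mem_range.mp hi
    rw [coeff_C_mul, coeff_eq_zero_of_natDegree_lt ((hd i).1.trans_lt (by omega)), mul_zero]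

theorem ord_mul [IsDomain k] {L M : DiffOp k} (hL : L ≠ 0) (hM : M ≠ 0) :
    (L * M).ord = L.ord + M.ord := by
  have h := coeff_mul_of_ord_le (le_refl L.ord) (le_refl M.ord)
  refine ord_eq_of_coeff (fun i hi => coeff_eq_zero_of_ord_lt (h.1.trans_lt hi)) ?_
  rw [h.2]
  exact mul_ne_zero (coeff_ord_ne_zero hL) (coeff_ord_ne_zero hM)

/-- Right division with remainder by a monic operator. -/
theorem Monic.exists_eq_mul_add {M : DiffOp k} (hM : M.Monic) (L : DiffOp k) :
    ∃ Q R : DiffOp k, L = Q * M + R ∧ ∀ i, M.ord ≤ i → R.coeff i = 0 := by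
  -- The induction runs on a bound for the support, because `ord` does not distinguish zero from
  -- nonzero constants.
  suffices h : ∀ (n : ℕ) (L : DiffOp k), (∀ i, n ≤ i → L.coeff i = 0) →
      ∃ Q R : DiffOp k, L = Q * M + R ∧ ∀ i, M.ord ≤ i → R.coeff i = 0 from
    h (L.ord + 1) L fun i hi => coeff_eq_zero_of_ord_lt hi
  intro n
  induction n with
  | zero => exact fun L hL => ⟨0, L, by simp, fun i _ => hL i (Nat.zero_le i)⟩
  | succ n ih =>
    intro L hL
    by_cases hn : n < M.ord
    · exact ⟨0, L, by simp, fun i hi => hL i (by omega)⟩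
    obtain ⟨j, rfl⟩ := Nat.exists_eq_add_of_le' (not_lt.mp hn)
    set Q₀ : DiffOp k := ofPoly (monomial j (L.coeff (j + M.ord))) with hQ₀
    have h := coeff_mul_of_ord_le (L := Q₀) (M := M) (l := j) (natDegree_monomial_le _) le_rfl
    obtain ⟨Q, R, hQR, hR⟩ := ih (L - Q₀ * M) (by
      intro i hi
      rw [coeff_sub]
      rcases hi.eq_or_lt with rfl | hi
      · rw [h.2, hM.coeff_ord, mul_one, sub_eq_zero]
        exact (coeff_monomial_same j (L.coeff (j + M.ord))).symm
      · rw [hL i hi, coeff_eq_zero_of_ord_lt (h.1.trans_lt hi), sub_zero])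
    refine ⟨Q + Q₀, R, ?_, hR⟩
    rw [add_mul, add_right_comm, ← hQR, sub_add_cancel]

end Coefficients

/-! ### Action of operators on differential extensions -/

section Evaluation

variable {k K : Type*} [Field k] [CommRing K] [Differential K] [Algebra k K]

theorem eval_ofPoly_add (p q : k[X]) (y : K) :
    (ofPoly (p + q)).eval y = (ofPoly p).eval y + (ofPoly q).eval y :=
  sum_add_index (p := p) (q := q) _ (by simp) (by simp [add_mul])

theorem eval_add_left (L M : DiffOp k) (y : K) : (L + M).eval y = L.eval y + M.eval y :=
  eval_ofPoly_add (toPoly L) (toPoly M) y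

@[simp] theorem eval_zero_left (y : K) : (0 : DiffOp k).eval y = 0 := sum_zero_index _

theorem eval_sub_left (L M : DiffOp k) (y : K) : (L - M).eval y = L.eval y - M.eval y := by
  rw [eq_sub_iff_add_eq, ← eval_add_left, sub_add_cancel]

theorem eval_ofPoly_monomial (i : ℕ) (a : k) (y : K) :
    (ofPoly (monomial i a)).eval y = algebraMap k K a * (fun z : K => z′)^[i] y :=
  sum_monomial_index a (fun i a => algebraMap k K a * (fun z : K => z′)^[i] y) (by simp)

theorem eval_eq_sum {L : DiffOp k} {n : ℕ} (h : ∀ i, n ≤ i → L.coeff i = 0) (y : K) :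
    L.eval y = ∑ i ∈ Finset.range n, algebraMap k K (L.coeff i) * (fun z : K => z′)^[i] y := by
  rcases eq_or_ne L 0 with rfl | hL
  · rw [eval_zero_left, Finset.sum_eq_zero]
    intro i _
    rw [show (0 : DiffOp k).coeff i = 0 from Polynomial.coeff_zero i, map_zero, zero_mul]
  · exact sum_over_range' (toPoly L) (by simp) n (ord_lt_of_coeff hL h)

theorem eval_add_right (L : DiffOp k) (x y : K) : L.eval (x + y) = L.eval x + L.eval y := by
  simp only [eval, sum_def, ← Finset.sum_add_distrib, iterate_deriv_add, mul_add]

theorem eval_map {K : Type*} [Field K] [Differential K] [Algebra k K] (L : DiffOp k) (y : K) :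
    (L.map K).eval y = L.eval y := by
  rw [eval_eq_sum (n := L.ord + 1), eval_eq_sum (n := L.ord + 1)]
  · exact Finset.sum_congr rfl fun i _ => congrArg (· * _) (coeff_map _ _)
  · exact fun i hi => coeff_eq_zero_of_ord_lt hi
  · intro i hi
    rw [show (L.map K).coeff i = algebraMap k K (L.coeff i) from coeff_map _ _,
      coeff_eq_zero_of_ord_lt hi, map_zero]

variable [Differential k] [DifferentialAlgebra k K]

theorem eval_ofPoly_delMul (p : k[X]) (y : K) :
    (ofPoly (delMul p)).eval y = ((ofPoly p).eval y)′ := by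
  induction p using Polynomial.induction_on' with
  | add p q hp hq => rw [map_add, eval_ofPoly_add, eval_ofPoly_add, hp, hq, map_add]
  | monomial i a =>
    rw [delMul_apply, Differential.mapCoeffs_monomial, X_mul_monomial, eval_ofPoly_add,
      eval_ofPoly_monomial, eval_ofPoly_monomial, eval_ofPoly_monomial, Derivation.leibniz,
      deriv_algebraMap, Function.iterate_succ_apply', smul_eq_mul, smul_eq_mul]
    ring

/-- Left multiplication by ∂ corresponds to differentiating the value, and powers and coefficients
follow by additivity. Solution spaces of products thereby become kernels of composites. -/
theorem eval_mul (L M : DiffOp k) (y : K) : (L * M).eval y = L.eval (M.eval y) := by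
  change (ofPoly (leftMul (toPoly L) (toPoly M))).eval y = (ofPoly (toPoly L)).eval (M.eval y)
  induction toPoly L using Polynomial.induction_on' with
  | add p q hp hq => rw [leftMul_add, LinearMap.add_apply, eval_ofPoly_add, hp, hq, eval_ofPoly_add]
  | monomial i a =>
    have hC : ∀ p : k[X], (ofPoly (C a * p)).eval y = algebraMap k K a * (ofPoly p).eval y := by
      intro p
      induction p using Polynomial.induction_on' with
      | add p q hp hq => rw [mul_add, eval_ofPoly_add, hp, hq, eval_ofPoly_add, mul_add]
      | monomial j b => rw [C_mul_monomial, eval_ofPoly_monomial, eval_ofPoly_monomial, map_mul,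
          mul_assoc]
    have hd : ∀ n : ℕ, (ofPoly ((delMul ^ n) (toPoly M))).eval y =
        (fun z : K => z′)^[n] (M.eval y) := by
      intro n
      induction n with
      | zero => rfl
      | succ n ih => rw [pow_succ', Module.End.mul_apply, eval_ofPoly_delMul, ih,
          Function.iterate_succ_apply']
    rw [leftMul_monomial, Module.End.mul_apply, LinearMap.mulLeft_apply, hC, hd,
      eval_ofPoly_monomial]

end Evaluation

/-! ### Dimension bound for solution spaces -/

section Rank

universe u v

variable {k : Type u} {K : Type v} [Field k] [Differential k] [Field K] [Differential K]
  [Algebra k K] [DifferentialAlgebra k K]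

theorem iterate_deriv_smul_of_const {C : Type*} [Field C] [Algebra C K]
    (hC : ∀ c : C, (algebraMap C K c)′ = 0) (i : ℕ) (c : C) (y : K) :
    (fun z : K => z′)^[i] (c • y) = c • (fun z : K => z′)^[i] y := by
  induction i with
  | zero => rfl
  | succ i ih =>
    simp only [Function.iterate_succ_apply', ih]
    rw [Algebra.smul_def, Algebra.smul_def, Derivation.leibniz, hC]
    simp

/-- The map `y ↦ L(y)` on an extension of `k`, linear over a field of constants. -/
noncomputable def evalLinear {C : Type*} [Field C] [Algebra C K]
    (hC : ∀ c : C, (algebraMap C K c)′ = 0) (L : DiffOp k) : K →ₗ[C] K where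
  toFun := L.eval
  map_add' := L.eval_add_right
  map_smul' c y := by
    simp only [eval, sum_def, iterate_deriv_smul_of_const hC, Finset.smul_sum, mul_smul_comm,
      RingHom.id_apply]

theorem _root_.LinearMap.rank_ker_comp_le {C : Type*} {V : Type v} [Field C] [AddCommGroup V]
    [Module C V] (f g : V →ₗ[C] V) :
    Module.rank C (LinearMap.ker (f ∘ₗ g)) ≤
      Module.rank C (LinearMap.ker f) + Module.rank C (LinearMap.ker g) := by
  have hg : ∀ x ∈ LinearMap.ker (f ∘ₗ g), g x ∈ LinearMap.ker f := fun x hx => hx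
  rw [← LinearMap.rank_range_add_rank_ker (g.restrict hg)]
  refine add_le_add (Submodule.rank_le _) ?_
  refine LinearMap.rank_le_of_injective
    (((LinearMap.ker (f ∘ₗ g)).subtype ∘ₗ
      (LinearMap.ker (g.restrict hg)).subtype).codRestrict (LinearMap.ker g) fun x => ?_) ?_
  · exact congrArg Subtype.val (LinearMap.mem_ker.mp x.2)
  · intro x y h
    exact Subtype.ext (Subtype.ext (Subtype.mk.inj h))

/-- The solutions of an operator of order `n` span at most `n` dimensions over the constants. -/
theorem rank_ker_evalLinear_le {C : Type*} [Field C] [Algebra C K]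
    (hC : ∀ x : K, x′ = 0 ↔ x ∈ (algebraMap C K).range) {P : DiffOp K} (hP : P ≠ 0) :
    Module.rank C (LinearMap.ker (P.evalLinear fun c => (hC _).mpr ⟨c, rfl⟩)) ≤ (P.ord : Cardinal)
    := by
  induction hn : P.ord using Nat.strong_induction_on generalizing P with
  | _ n ih =>
    by_cases hker : LinearMap.ker (P.evalLinear fun c => (hC _).mpr ⟨c, rfl⟩) = ⊥
    · rw [hker]
      simp
    obtain ⟨y, hy, hy0⟩ := Submodule.exists_mem_ne_zero_of_ne_bot hker
    replace hy : P.eval y = 0 := hy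
    -- Reduction of order: D is the monic first-order operator killing the nonzero solution y. The
    -- remainder of P by D is multiplication by an element that kills y, so P = QD.
    set D : DiffOp K := ofPoly (X - Polynomial.C (y′ / y)) with hD
    have hDm : D.Monic := monic_X_sub_C _
    have hD1 : D.ord = 1 := natDegree_X_sub_C _
    have hDe : ∀ z : K, D.eval z = z′ - y′ / y * z := by
      intro z
      have hX : (ofPoly (X : K[X])).eval z = z′ := by
        rw [← monomial_one_one_eq_X, eval_ofPoly_monomial]
        simp
      have hY : (ofPoly (Polynomial.C (y′ / y))).eval z = y′ / y * z := by
        rw [← monomial_zero_left, eval_ofPoly_monomial]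
        simp
      rw [← hX, ← hY, ← eval_sub_left]
      rfl
    obtain ⟨Q, R, hQR, hR⟩ := hDm.exists_eq_mul_add P
    have hRe : ∀ z : K, R.eval z = R.coeff 0 * z := by
      intro z
      rw [eval_eq_sum (n := 1) (by rwa [hD1] at hR)]
      simp
    have hR0 : R = 0 := by
      have h0 : R.coeff 0 * y = 0 := by
        rw [← hRe, ← hy, hQR, eval_add_left, eval_mul, hDe, div_mul_cancel₀ _ hy0, sub_self,
          show Q.eval (0 : K) = 0 from
            (Q.evalLinear (K := K) fun c => (hC _).mpr ⟨c, rfl⟩).map_zero, zero_add]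
      refine ext_coeff fun i => ?_
      rcases Nat.eq_zero_or_pos i with rfl | hi
      · exact ((mul_eq_zero.mp h0).resolve_right hy0).trans (Polynomial.coeff_zero 0).symm
      · exact (hR i (by omega)).trans (Polynomial.coeff_zero i).symm
    rw [hR0, add_zero] at hQR
    have hQ : Q ≠ 0 := by
      rintro rfl
      exact hP (by rw [hQR, zero_mul])
    have hord : Q.ord + 1 = n := by rw [← hn, hQR, ord_mul hQ hDm.ne_zero, hD1]
    have hcomp : P.evalLinear (fun c => (hC _).mpr ⟨c, rfl⟩) =
        Q.evalLinear (C := C) (K := K) (fun c => (hC _).mpr ⟨c, rfl⟩) ∘ₗ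
          D.evalLinear (fun c => (hC _).mpr ⟨c, rfl⟩) := by
      ext z
      change P.eval z = Q.eval (D.eval z)
      rw [hQR, eval_mul]
    rw [hcomp, ← hord]
    push_cast
    refine (LinearMap.rank_ker_comp_le _ _).trans (add_le_add (ih _ (by omega) hQ rfl) ?_)
    have hle : LinearMap.ker (D.evalLinear (C := C) (K := K) fun c => (hC _).mpr ⟨c, rfl⟩) ≤
        Submodule.span C {y} := by
      intro z hz
      replace hz : z′ - y′ / y * z = 0 := (hDe z).symm.trans hz
      -- The quotient of two solutions of a first-order equation is constant, so ker D is a line.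
      have hc : (z / y)′ = 0 := by
        rw [Derivation.leibniz_div, smul_eq_mul, smul_eq_mul, sub_eq_zero.mp hz]
        field_simp
        ring
      obtain ⟨c, hc⟩ := (hC _).mp hc
      refine Submodule.mem_span_singleton.mpr ⟨c, ?_⟩
      rw [Algebra.smul_def, hc, div_mul_cancel₀ _ hy0]
    refine (Submodule.rank_mono hle).trans ((rank_span_le _).trans ?_)
    simp

end Rank

end DiffOp

/-! ### Maximal differential ideals and their constants -/

section DifferentialIdeals

variable {B : Type*} [CommRing B] [Differential B]

/-- An ideal stable under the derivation. -/
def Ideal.IsDifferential (I : Ideal B) : Prop := ∀ x ∈ I, x′ ∈ I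

/-- A proper differential ideal that is maximal among the proper differential ideals. -/
def Ideal.IsMaximalDifferential (P : Ideal B) : Prop :=
  Maximal (fun I : Ideal B => I.IsDifferential ∧ I ≠ ⊤) P

theorem Ideal.IsDifferential.sup_span_singleton {P : Ideal B} (hP : P.IsDifferential) {c : B}
    (hc : c′ ∈ P ⊔ Ideal.span {c}) : (P ⊔ Ideal.span {c}).IsDifferential := by
  intro x hx
  obtain ⟨p, hp, y, hy, rfl⟩ := Submodule.mem_sup.mp hx
  obtain ⟨b, rfl⟩ := Ideal.mem_span_singleton'.mp hy
  rw [map_add, Derivation.leibniz, smul_eq_mul, smul_eq_mul]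
  refine add_mem (Ideal.mem_sup_left (hP p hp)) (add_mem (Ideal.mul_mem_left _ _ hc) ?_)
  exact Ideal.mul_mem_right _ _ (Ideal.mem_sup_right (Ideal.mem_span_singleton_self c))

theorem Ideal.IsDifferential.exists_le_isMaximalDifferential {I : Ideal B}
    (hI : I.IsDifferential) (hI' : I ≠ ⊤) : ∃ P : Ideal B, I ≤ P ∧ P.IsMaximalDifferential := by
  refine zorn_le_nonempty₀ {I : Ideal B | I.IsDifferential ∧ I ≠ ⊤} ?_ I ⟨hI, hI'⟩
  intro c hc hchain J hJ
  have hmem : ∀ x, x ∈ sSup c ↔ ∃ J ∈ c, x ∈ J := fun x =>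
    Submodule.mem_sSup_of_directed ⟨J, hJ⟩ hchain.directedOn
  refine ⟨sSup c, ⟨?_, ?_⟩, fun _ => le_sSup⟩
  · intro x hx
    obtain ⟨J, hJ, hx⟩ := (hmem x).mp hx
    exact (hmem _).mpr ⟨J, hJ, (hc hJ).1 x hx⟩
  · rw [Ne, Ideal.eq_top_iff_one, hmem]
    rintro ⟨J, hJ, h⟩
    exact (hc hJ).2 ((Ideal.eq_top_iff_one _).mpr h)

/-- By Chevalley's theorem an element of a finitely generated algebra over a field `F` that is
transcendental over `F` takes all but finitely many values in `F`. -/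
theorem Algebra.FiniteType.exists_not_isUnit_sub_of_transcendental {F Q : Type*} [Field F]
    [CommRing Q] [Algebra F Q] [Algebra.FiniteType F Q] {c : Q} (hc : Transcendental F c)
    {S : Set F} (hS : S.Infinite) : ∃ e ∈ S, ¬ IsUnit (c - algebraMap F Q e) := by
  set φ : F[X] →+* Q := (aeval c : F[X] →ₐ[F] Q).toRingHom with hφ
  have hinj : Function.Injective φ := transcendental_iff_injective.mp hc
  have hft : φ.FiniteType := by
    refine RingHom.FiniteType.of_comp_finiteType (f := C) ?_
    have : φ.comp C = algebraMap F Q := by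
      ext x
      simp [hφ]
    rw [this]
    exact RingHom.finiteType_algebraMap.mpr inferInstance
  obtain ⟨T, hT⟩ := PrimeSpectrum.exists_constructibleSetData_iff.mpr
    (PrimeSpectrum.isConstructible_range_comap (RingHom.FinitePresentation.of_finiteType.mp hft))
  -- As φ is injective, the generic point of the line is in the image of Spec Q. The constructible
  -- piece containing it has all g equal to 0 and f ≠ 0, so it is a nonempty basic open set.
  have hbot : (⊥ : PrimeSpectrum F[X]) ∈ T.toSet := by
    rw [hT]
    have : (⊥ : Ideal F[X]) ∈ minimalPrimes F[X] := by
      rw [IsDomain.minimalPrimes_eq_singleton_bot]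
      rfl
    obtain ⟨p, hp, h⟩ := Ideal.exists_comap_eq_of_mem_minimalPrimes_of_injective hinj _ this
    exact ⟨⟨p, hp⟩, PrimeSpectrum.ext h⟩
  simp only [PrimeSpectrum.ConstructibleSetData.toSet, Set.mem_iUnion] at hbot
  obtain ⟨D, hD, hg, hf⟩ := hbot
  have hf0 : D.f ≠ 0 := by
    intro h
    apply hf
    rw [h]
    simp
  have hg0 : ∀ i, D.g i = 0 := fun i => by
    simpa using (PrimeSpectrum.mem_zeroLocus _ _).mp hg (Set.mem_range_self i)
  obtain ⟨e, heS, he⟩ : ∃ e ∈ S, D.f.eval e ≠ 0 := by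
    by_contra! h
    exact hf0 (eq_zero_of_infinite_isRoot _ (hS.mono h))
  refine ⟨e, heS, fun hu => ?_⟩
  have hprime : (Ideal.span {X - C e} : Ideal F[X]).IsPrime :=
    (Ideal.span_singleton_prime (X_sub_C_ne_zero e)).mpr (prime_X_sub_C e)
  -- Since f(e) ≠ 0, the point (X − e) is in the image as well; a prime of Q above it contains c −
  -- e.
  have hmem : (⟨_, hprime⟩ : PrimeSpectrum F[X]) ∈ T.toSet := by
    simp only [PrimeSpectrum.ConstructibleSetData.toSet, Set.mem_iUnion]
    refine ⟨D, hD, ?_, ?_⟩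
    · rw [PrimeSpectrum.mem_zeroLocus]
      rintro _ ⟨i, rfl⟩
      rw [hg0]
      exact zero_mem _
    · rw [PrimeSpectrum.mem_zeroLocus, Set.singleton_subset_iff]
      intro h
      exact he (dvd_iff_isRoot.mp (Ideal.mem_span_singleton.mp h))
  rw [hT] at hmem
  obtain ⟨p, hp⟩ := hmem
  have hXp : (X - C e : F[X]) ∈ (PrimeSpectrum.comap φ p).asIdeal := by
    rw [hp]
    exact Ideal.mem_span_singleton_self _
  refine p.2.ne_top (Ideal.eq_top_of_isUnit_mem _ (x := c - algebraMap F Q e) ?_ hu)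
  simpa [hφ] using hXp

/-- A finitely generated differential algebra has no new constants modulo a maximal differential
ideal, if the constants of the base field are algebraically closed. -/
theorem Ideal.IsMaximalDifferential.exists_sub_mem {C F : Type*} [Field C] [IsAlgClosed C]
    [Field F] [Differential F] [Algebra C F] (hC : ∀ x : F, x′ = 0 ↔ x ∈ (algebraMap C F).range)
    [Algebra F B] [DifferentialAlgebra F B] [Algebra.FiniteType F B] {P : Ideal B}
    (hP : P.IsMaximalDifferential) {c : B} (hc : c′ ∈ P) :
    ∃ e : C, c - algebraMap F B (algebraMap C F e) ∈ P := by
  by_contra! hne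
  -- c − e is constant modulo P, so adjoining it to P gives a differential ideal; maximality makes
  -- that ideal the whole ring.
  have hunit : ∀ e : C,
      IsUnit (Ideal.Quotient.mk P c - algebraMap F (B ⧸ P) (algebraMap C F e)) := by
    intro e
    have he' : (c - algebraMap F B (algebraMap C F e))′ ∈ P := by
      rwa [map_sub, deriv_algebraMap, (hC _).mpr ⟨e, rfl⟩, map_zero, sub_zero]
    have htop : P ⊔ Ideal.span {c - algebraMap F B (algebraMap C F e)} = ⊤ := by
      by_contra htop
      have := hP.le_of_ge ⟨hP.prop.1.sup_span_singleton (Ideal.mem_sup_left he'), htop⟩ le_sup_left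
      exact hne e (this (Ideal.mem_sup_right (Ideal.mem_span_singleton_self _)))
    obtain ⟨p, hp, y, hy, h⟩ := Submodule.mem_sup.mp ((Ideal.eq_top_iff_one _).mp htop)
    obtain ⟨b, rfl⟩ := Ideal.mem_span_singleton'.mp hy
    refine IsUnit.of_mul_eq_one_right (Ideal.Quotient.mk P b) ?_
    rw [← Ideal.Quotient.mk_algebraMap, ← map_sub, ← map_mul, ← map_one (Ideal.Quotient.mk P),
      ← h, map_add, Ideal.Quotient.eq_zero_iff_mem.mpr hp, zero_add]
  have : Nontrivial (B ⧸ P) := Ideal.Quotient.nontrivial_iff.mpr hP.prop.2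
  by_cases halg : IsAlgebraic F (Ideal.Quotient.mk P c)
  · have hint := halg.isIntegral
    set p := minpoly F (Ideal.Quotient.mk P c) with hp
    have hmk : ∀ q : F[X], aeval (Ideal.Quotient.mk P c) q = 0 ↔ aeval c q ∈ P := by
      intro q
      rw [← Ideal.Quotient.eq_zero_iff_mem, ← Ideal.Quotient.mkₐ_eq_mk F, aeval_algHom_apply]
    -- Differentiating p(c) ∈ P and using c′ ∈ P, the polynomial with differentiated coefficients
    -- also kills c modulo P. As p is monic this polynomial has smaller degree, so it vanishes.
    -- Hence p has coefficients in C and splits there, making a product of units c − e equal to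
    -- zero.
    have hp0 : Differential.mapCoeffs p = 0 := by
      by_contra h0
      have h : aeval (Ideal.Quotient.mk P c) (Differential.mapCoeffs p) = 0 := by
        rw [hmk, eq_sub_of_add_eq (Differential.deriv_aeval_eq c p).symm]
        exact sub_mem (hP.prop.1 _ ((hmk p).mp (minpoly.aeval _ _))) (Ideal.mul_mem_left _ _ hc)
      refine (minpoly.degree_le_of_ne_zero F _ h0 h).not_gt ?_
      refine (degree_lt_iff_coeff_zero _ _).mpr ?_ |>.trans_eq
        (degree_eq_natDegree (minpoly.ne_zero hint)).symm
      intro m hm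
      rw [Differential.coeff_mapCoeffs]
      rcases hm.eq_or_lt with rfl | hm
      · rw [coeff_natDegree, minpoly.monic hint]
        simp
      · rw [coeff_eq_zero_of_natDegree_lt hm, map_zero]
    have hlift : p ∈ lifts (algebraMap C F) := by
      rw [lifts_iff_coeff_lifts]
      intro i
      refine (hC _).mp ?_
      rw [← Differential.coeff_mapCoeffs, hp0, Polynomial.coeff_zero]
    obtain ⟨q, hq, -, hqm⟩ := lifts_and_degree_eq_and_monic hlift (minpoly.monic hint)
    have h0 : aeval (Ideal.Quotient.mk P c) p = 0 := minpoly.aeval _ _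
    rw [← hq, (IsAlgClosed.splits q).eq_prod_roots_of_monic hqm] at h0
    simp only [Polynomial.map_multiset_prod, Multiset.map_map, map_multiset_prod,
      Function.comp_def, Polynomial.map_sub, map_X, map_C, map_sub, aeval_X, aeval_C] at h0
    have hu : IsUnit (Multiset.map (fun e => Ideal.Quotient.mk P c -
        algebraMap F (B ⧸ P) (algebraMap C F e)) q.roots).prod := by
      induction q.roots using Multiset.induction_on with
      | empty => simp
      | cons e s ih =>
        rw [Multiset.map_cons, Multiset.prod_cons]
        exact (hunit e).mul ih
    rw [h0] at hu
    exact not_isUnit_zero hu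
  · obtain ⟨e, ⟨e', rfl⟩, he⟩ := Algebra.FiniteType.exists_not_isUnit_sub_of_transcendental halg
      (Set.infinite_range_of_injective (algebraMap C F).injective)
    exact he (hunit e')

end DifferentialIdeals

/-! ### Fundamental matrices -/

section Matrix

variable {B : Type*} [CommRing B] [Differential B] {n : ℕ}

theorem Matrix.map_deriv_mul (M N : Matrix (Fin n) (Fin n) B) :
    (M * N).map (fun z => z′) = M.map (fun z => z′) * N + M * N.map (fun z => z′) := by
  ext i j
  simp only [Matrix.map_apply, Matrix.mul_apply, Matrix.add_apply, map_sum, Derivation.leibniz,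
    smul_eq_mul, Finset.sum_add_distrib]
  rw [add_comm]
  exact congrArg (· + _) (Finset.sum_congr rfl fun _ _ => mul_comm _ _)

/-- Two solution matrices of the same equation differ by a constant matrix. -/
theorem Matrix.map_deriv_mul_eq_zero {A Y₁ Y₂ N : Matrix (Fin n) (Fin n) B}
    (h₁ : Y₁.map (fun z => z′) = A * Y₁) (h₂ : Y₂.map (fun z => z′) = A * Y₂) (hN : N * Y₁ = 1) :
    (N * Y₂).map (fun z => z′) = 0 := by
  have hN' : Y₁ * N = 1 := mul_eq_one_comm.mp hN
  -- Differentiating N Y₁ = 1 gives N′ = −NA, which cancels against Y₂′ = AY₂.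
  have h : N.map (fun z => z′) * Y₁ + N * (A * Y₁) = 0 := by
    rw [← h₁, ← Matrix.map_deriv_mul, hN]
    ext i j
    by_cases hij : i = j
    · simp [Matrix.map_apply, hij]
    · simp [Matrix.map_apply, hij]
  have h' : N.map (fun z => z′) = -(N * A) := by
    have := congrArg (· * N) h
    simp only [add_mul, Matrix.mul_assoc, hN', Matrix.mul_one, zero_mul] at this
    exact eq_neg_of_add_eq_zero_left this
  rw [Matrix.map_deriv_mul, h', h₂, Matrix.neg_mul, Matrix.mul_assoc, neg_add_cancel]

theorem Matrix.GeneralLinearGroup.isUnit_det_map {n : ℕ} {R : Type*} [CommRing R]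
    (Z : Matrix.GeneralLinearGroup (Fin n) R) (K : Type*) [CommRing K] [Algebra R K] :
    IsUnit ((Z : Matrix (Fin n) (Fin n) R).map (algebraMap R K)).det := by
  have : ((Z : Matrix (Fin n) (Fin n) R).map (algebraMap R K)).det =
      algebraMap R K (Z : Matrix (Fin n) (Fin n) R).det := ((algebraMap R K).map_det _).symm
  rw [this]
  exact ((Matrix.isUnit_iff_isUnit_det _).mp Z.isUnit).map _

end Matrix

/-! ### Constants of a Picard–Vessiot field and extension of homomorphisms -/

section PicardVessiotRings

variable {k : Type*} [Field k] [Differential k] {n : ℕ} {A : Matrix (Fin n) (Fin n) k}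
  {R : Type*} [CommRing R] [Differential R] [Algebra k R] [DifferentialAlgebra k R]

/-- This lets the result on constants modulo a maximal differential ideal be applied to R itself. -/
theorem IsSimpleDifferentialRing.isMaximalDifferential_bot (h : IsSimpleDifferentialRing R) :
    (⊥ : Ideal R).IsMaximalDifferential := by
  have := h.1
  refine ⟨⟨fun x hx => ?_, bot_ne_top⟩, fun I hI _ => ((h.2 I hI.1).resolve_right hI.2).le⟩
  rw [(Submodule.mem_bot R).mp hx, map_zero]
  exact zero_mem _

theorem IsPVRing.finiteType (h : IsPVRing A R) : Algebra.FiniteType k R := by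
  obtain ⟨-, Z, -, hZ⟩ := h
  refine ⟨Subalgebra.fg_def.mpr ⟨_, Set.Finite.union ?_ (Set.finite_singleton _), hZ⟩⟩
  refine (Set.finite_range fun p : Fin n × Fin n => (Z : Matrix (Fin n) (Fin n) R) p.1 p.2).subset ?_
  rintro _ ⟨i, j, rfl⟩
  exact ⟨(i, j), rfl⟩

omit [Differential k] [DifferentialAlgebra k R] in
theorem IsFundamentalMatrix.map_deriv {Z : Matrix.GeneralLinearGroup (Fin n) R}
    (hZ : IsFundamentalMatrix A Z) (K : Type*) [CommRing K] [Differential K] [Algebra k K]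
    [Algebra R K] [DifferentialAlgebra R K] [IsScalarTower k R K] :
    ((Z : Matrix (Fin n) (Fin n) R).map (algebraMap R K)).map (fun z => z′) =
      A.map (algebraMap k K) * (Z : Matrix (Fin n) (Fin n) R).map (algebraMap R K) := by
  have := congrArg (fun M => Matrix.map M (algebraMap R K)) hZ
  simp only [Matrix.map_mul, Matrix.map_map, Function.comp_def] at this
  rw [Matrix.map_map]
  convert this using 2
  · funext z
    exact deriv_algebraMap z
  · ext i j
    simp [← IsScalarTower.algebraMap_apply]

theorem forall_constants_iff : ∀ x : k, x′ = 0 ↔ x ∈ (algebraMap (fieldOfConstants k) k).range :=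
  fun x => ⟨fun hx => ⟨⟨x, hx⟩, rfl⟩, by rintro ⟨c, rfl⟩; exact c.2⟩

variable {K : Type*} [Field K] [Differential K] [Algebra k K] [DifferentialAlgebra k K]
  [Algebra R K] [DifferentialAlgebra R K] [IsScalarTower k R K] [IsFractionRing R K]

/-- A Picard-Vessiot field has the same constants as the base field. -/
theorem IsPVRing.constants_iff [IsAlgClosed (fieldOfConstants k)] (h : IsPVRing A R) (x : K) :
    x′ = 0 ↔ x ∈ (algebraMap (fieldOfConstants k) K).range := by
  constructor
  · intro hx
    -- The ideal of denominators of x. It is differential because x is constant, and nonzero because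
    -- x is a fraction, so simplicity gives 1 ∈ I and x ∈ R.
    set I : Ideal R :=
      (LinearMap.range (Algebra.linearMap R K)).comap (LinearMap.toSpanSingleton R K x)
      with hI
    have hmem : ∀ r : R, r ∈ I ↔ ∃ s : R, algebraMap R K s = algebraMap R K r * x := fun r => by
      rw [hI, Submodule.mem_comap, LinearMap.toSpanSingleton_apply, Algebra.smul_def]
      rfl
    have hdiff : I.IsDifferential := by
      intro r hr
      obtain ⟨s, hs⟩ := (hmem r).mp hr
      refine (hmem _).mpr ⟨s′, ?_⟩
      rw [← deriv_algebraMap, hs, Derivation.leibniz, hx, ← deriv_algebraMap]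
      simp [mul_comm]
    have := h.1.1
    have hI0 : I ≠ ⊥ := by
      obtain ⟨b, c, hc, hbc⟩ := IsFractionRing.div_surjective (A := R) x
      have hbI : c ∈ I := (hmem c).mpr ⟨b, by
        rw [← hbc, mul_div_cancel₀]
        exact IsFractionRing.to_map_ne_zero_of_mem_nonZeroDivisors hc⟩
      intro h0
      rw [h0] at hbI
      exact nonZeroDivisors.ne_zero hc ((Submodule.mem_bot R).mp hbI)
    have h1 : (1 : R) ∈ I := by rw [(h.1.2 I hdiff).resolve_left hI0]; trivial
    obtain ⟨s, hs⟩ := (hmem 1).mp h1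
    rw [map_one, one_mul] at hs
    have : IsDomain R := (IsFractionRing.injective R K).isDomain
    have hs' : s′ = 0 := by
      apply IsFractionRing.injective R K
      rw [← deriv_algebraMap, hs, hx, map_zero]
    have := h.finiteType
    obtain ⟨e, he⟩ := h.1.isMaximalDifferential_bot.exists_sub_mem
      (forall_constants_iff (k := k))
      (c := s) (by rw [hs']; exact zero_mem _)
    refine ⟨e, ?_⟩
    rw [← hs, sub_eq_zero.mp ((Submodule.mem_bot R).mp he), ← IsScalarTower.algebraMap_apply]
    rfl
  · rintro ⟨c, rfl⟩
    change (algebraMap k K c)′ = 0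
    have hc : ((c : k))′ = 0 := c.2
    rw [deriv_algebraMap, hc, map_zero]

omit [DifferentialAlgebra k K] [IsFractionRing R K] in
/-- A differential homomorphism from a Picard-Vessiot ring to a finitely generated differential
algebra over `K` takes values in `K` modulo any maximal differential ideal. -/
theorem IsPVRing.exists_algHom_of_isMaximalDifferential {C : Type*} [Field C] [IsAlgClosed C]
    [Algebra C K] (hC : ∀ x : K, x′ = 0 ↔ x ∈ (algebraMap C K).range) (h : IsPVRing A R)
    {B : Type*} [CommRing B] [Differential B] [Algebra K B] [DifferentialAlgebra K B]
    [Algebra k B] [IsScalarTower k K B] [Algebra.FiniteType K B]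
    {P : Ideal B} (hP : P.IsMaximalDifferential) (ζ : R →ₐ[k] B) (hζ : ∀ r, ζ (r′) = (ζ r)′) :
    ∃ σ : R →ₐ[k] K, (∀ r, σ (r′) = (σ r)′) ∧ ∀ r, ζ r - algebraMap K B (σ r) ∈ P := by
  have : Nontrivial (B ⧸ P) := Ideal.Quotient.nontrivial_iff.mpr hP.prop.2
  obtain ⟨-, Z, hZ, hgen⟩ := h
  set Zm : Matrix (Fin n) (Fin n) R := Units.val Z with hZm
  -- H consists of the elements congruent to an element of K modulo P; it suffices to put the
  -- generators of R into it.
  set H : Subalgebra K B := (⊥ : Subalgebra K (B ⧸ P)).comap (Ideal.Quotient.mkₐ K P) with hH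
  have hmem : ∀ b : B, b ∈ H ↔ ∃ e : K, b - algebraMap K B e ∈ P := by
    intro b
    rw [hH, Subalgebra.mem_comap, Algebra.mem_bot]
    refine exists_congr fun e => ?_
    rw [eq_comm, ← Ideal.Quotient.mk_algebraMap, Ideal.Quotient.mkₐ_eq_mk,
      Ideal.Quotient.mk_eq_mk_iff_sub_mem]
  set Y : Matrix (Fin n) (Fin n) K := Zm.map (algebraMap R K) with hY
  have hYdet : IsUnit Y.det := Z.isUnit_det_map K
  have hYd : Y.map (fun z => z′) = A.map (algebraMap k K) * Y := hZ.map_deriv K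
  have hζd : (Zm.map ζ).map (fun z => z′) =
      (A.map (algebraMap k K)).map (algebraMap K B) * Zm.map ζ := by
    have := congrArg (fun M => Matrix.map M ζ) hZ
    simp only [Matrix.map_mul, Matrix.map_map, Function.comp_def] at this
    rw [Matrix.map_map, Matrix.map_map]
    convert this using 2
    · funext z
      exact (hζ z).symm
    · ext i j
      simp [← IsScalarTower.algebraMap_apply]
  have hYB : (Y.map (algebraMap K B)).map (fun z => z′) =
      (A.map (algebraMap k K)).map (algebraMap K B) * Y.map (algebraMap K B) := by
    rw [← Matrix.map_mul, ← hYd, Matrix.map_map, Matrix.map_map]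
    exact congrArg (Matrix.map Y) (funext fun z => deriv_algebraMap z)
  have hYi : (Y⁻¹).map (algebraMap K B) * Y.map (algebraMap K B) = 1 := by
    rw [← Matrix.map_mul, Matrix.nonsing_inv_mul _ hYdet, Matrix.map_one _ (map_zero _) (map_one _)]
  have hconst := Matrix.map_deriv_mul_eq_zero hYB hζd hYi
  -- The transition matrix between Y and ζ(Z) is constant, so its entries are congruent to constants
  -- modulo P.
  set M := (Y⁻¹).map (algebraMap K B) * Zm.map ζ with hM
  have hMmem : ∀ i j, M i j ∈ H := by
    intro i j
    have h0 : (M i j)′ ∈ P := by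
      have := congrFun (congrFun hconst i) j
      rw [Matrix.map_apply] at this
      rw [this]
      exact zero_mem _
    obtain ⟨e, he⟩ := hP.exists_sub_mem hC h0
    exact (hmem _).mpr ⟨_, he⟩
  have hζM : Zm.map ζ = Y.map (algebraMap K B) * M := by
    rw [hM, ← Matrix.mul_assoc, mul_eq_one_comm.mp hYi, Matrix.one_mul]
  have hζmem : ∀ i j, ζ (Zm i j) ∈ H := by
    intro i j
    have := congrFun (congrFun hζM i) j
    rw [Matrix.map_apply] at this
    rw [this, Matrix.mul_apply]
    exact sum_mem fun l _ => mul_mem (H.algebraMap_mem _) (hMmem l j)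
  have hinv : ∀ u : Rˣ, ζ u ∈ H → ζ (u⁻¹ : Rˣ) ∈ H := by
    intro u hu
    obtain ⟨e, he⟩ := (hmem _).mp hu
    have he0 : e ≠ 0 := by
      rintro rfl
      rw [map_zero, sub_zero] at he
      exact hP.prop.2 (Ideal.eq_top_of_isUnit_mem _ he (u.isUnit.map ζ))
    refine (hmem _).mpr ⟨e⁻¹, ?_⟩
    have : ζ (u⁻¹ : Rˣ) - algebraMap K B e⁻¹ =
        -(ζ (u⁻¹ : Rˣ) * algebraMap K B e⁻¹) * (ζ u - algebraMap K B e) := by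
      have h1 : ζ (u⁻¹ : Rˣ) * ζ u = 1 := by rw [← map_mul, Units.inv_mul, map_one]
      have h2 : algebraMap K B e⁻¹ * algebraMap K B e = 1 := by
        rw [← map_mul, inv_mul_cancel₀ he0, map_one]
      linear_combination algebraMap K B e⁻¹ * h1 - ζ (u⁻¹ : Rˣ) * h2
    rw [this]
    exact Ideal.mul_mem_left _ _ he
  have hall : ∀ r : R, ζ r ∈ H := by
    have hle : (⊤ : Subalgebra k R) ≤ (H.restrictScalars k).comap ζ := by
      rw [← hgen, Algebra.adjoin_le_iff]
      rintro _ (⟨i, j, rfl⟩ | rfl)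
      · exact hζmem i j
      · refine hinv (Matrix.GeneralLinearGroup.det Z) ?_
        have : (Matrix.GeneralLinearGroup.det Z : R) = Zm.det := rfl
        rw [this, Matrix.det_apply, map_sum]
        refine sum_mem fun τ _ => ?_
        rw [Units.smul_def, map_zsmul, map_prod]
        exact zsmul_mem (prod_mem fun i _ => hζmem _ _) _
    exact fun r => hle (Algebra.mem_top (x := r))
  have hinj : Function.Injective (algebraMap K (B ⧸ P)) := (algebraMap K (B ⧸ P)).injective
  let f : R →ₐ[k] (⊥ : Subalgebra K (B ⧸ P)).restrictScalars k :=
    ((Ideal.Quotient.mkₐ k P).comp ζ).codRestrict _ hall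
  let σ : R →ₐ[k] K :=
    (((Algebra.botEquivOfInjective hinj).restrictScalars k).toAlgHom).comp f
  have hσ : ∀ r, ζ r - algebraMap K B (σ r) ∈ P := by
    intro r
    rw [← Ideal.Quotient.mk_eq_mk_iff_sub_mem, Ideal.Quotient.mk_algebraMap]
    have h1 : (Algebra.botEquivOfInjective hinj).symm (σ r) = f r :=
      (Algebra.botEquivOfInjective hinj).symm_apply_apply _
    exact (congrArg Subtype.val h1).symm
  -- Both σ(r′) and σ(r)′ are congruent to ζ(r′) modulo P, and K embeds in B/P.
  refine ⟨σ, fun r => hinj ?_, hσ⟩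
  rw [← Ideal.Quotient.mk_algebraMap, ← Ideal.Quotient.mk_algebraMap,
    Ideal.Quotient.mk_eq_mk_iff_sub_mem, ← deriv_algebraMap]
  have h1 := hP.prop.1 _ (hσ r)
  rw [map_sub, ← hζ] at h1
  have := sub_mem h1 (hσ (r′))
  rwa [sub_sub_sub_cancel_left] at this

/-- A differential homomorphism from a Picard-Vessiot ring to its field of fractions extends to a
differential automorphism. -/
theorem IsPVRing.exists_mem_DGal [IsAlgClosed (fieldOfConstants k)] (h : IsPVRing A R)
    (σ : R →ₐ[k] K) (hσ : ∀ r, σ (r′) = (σ r)′) :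
    ∃ τ ∈ DGal k K, ∀ r, τ (algebraMap R K r) = σ r := by
  have hCK := h.constants_iff (K := K)
  have hinj : Function.Injective σ := by
    rw [injective_iff_map_eq_zero]
    have hd : (RingHom.ker σ).IsDifferential := by
      intro x hx
      rw [RingHom.mem_ker] at hx ⊢
      rw [hσ, hx, map_zero]
    have := (h.1.2 _ hd).resolve_right (RingHom.ker_ne_top _)
    intro x hx
    have hx' : x ∈ RingHom.ker σ := hx
    rwa [this] at hx'
  let τ : K →ₐ[k] K := IsFractionRing.liftAlgHom (K := K) hinj
  have hτ : ∀ r, τ (algebraMap R K r) = σ r := fun r => IsFractionRing.lift_algebraMap hinj r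
  have hτd : ∀ x, τ (x′) = (τ x)′ := by
    intro x
    obtain ⟨b, c, hc, rfl⟩ := IsFractionRing.div_surjective (A := R) x
    rw [Derivation.leibniz_div, map_div₀, Derivation.leibniz_div, deriv_algebraMap,
      deriv_algebraMap]
    simp only [smul_eq_mul, map_mul, map_inv₀, map_sub, hτ, hσ, map_pow]
  obtain ⟨-, Z, hZ, hgen⟩ := h
  set Y : Matrix (Fin n) (Fin n) K := (Z : Matrix (Fin n) (Fin n) R).map (algebraMap R K) with hY
  have hYdet : IsUnit Y.det := Z.isUnit_det_map K
  have hYd : Y.map (fun z => z′) = A.map (algebraMap k K) * Y := hZ.map_deriv K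
  have hτY : (Y.map τ).map (fun z => z′) = A.map (algebraMap k K) * Y.map τ := by
    have := congrArg (fun M => Matrix.map M τ) hYd
    simp only [Matrix.map_mul, Matrix.map_map, Function.comp_def] at this
    rw [Matrix.map_map]
    convert this using 2
    · funext z
      exact (hτd z).symm
    · ext i j
      simp
  have hτdet : IsUnit (Y.map τ).det := by
    have : (Y.map τ).det = τ Y.det := (AlgHom.map_det τ Y).symm
    rw [this]
    exact hYdet.map τ
  have hconst := Matrix.map_deriv_mul_eq_zero hτY hYd (Matrix.nonsing_inv_mul _ hτdet)
  -- Surjectivity: Y and τ(Y) differ by a matrix of constants, which lie in k and hence in the image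
  -- of τ.
  have hYmem : ∀ i j, Y i j ∈ τ.fieldRange := by
    intro i j
    have : Y = Y.map τ * ((Y.map τ)⁻¹ * Y) := by
      rw [← Matrix.mul_assoc, Matrix.mul_nonsing_inv _ hτdet, Matrix.one_mul]
    rw [this, Matrix.mul_apply]
    refine sum_mem fun l _ => mul_mem ⟨Y i l, rfl⟩ ?_
    obtain ⟨c, hc⟩ := (hCK _).mp (congrFun (congrFun hconst l) j)
    rw [← hc]
    exact τ.fieldRange.algebraMap_mem (c : k)
  have hRmem : ∀ r : R, algebraMap R K r ∈ τ.fieldRange := by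
    have hle : (⊤ : Subalgebra k R) ≤
        τ.fieldRange.toSubalgebra.comap (IsScalarTower.toAlgHom k R K) := by
      rw [← hgen, Algebra.adjoin_le_iff]
      rintro _ (⟨i, j, rfl⟩ | rfl)
      · exact hYmem i j
      · change algebraMap R K _ ∈ τ.fieldRange
        have hdet : algebraMap R K (Matrix.GeneralLinearGroup.det Z) = Y.det :=
          (algebraMap R K).map_det _
        have hinv : algebraMap R K ((Matrix.GeneralLinearGroup.det Z)⁻¹ : Rˣ) = (Y.det)⁻¹ := by
          rw [← hdet]
          refine eq_inv_of_mul_eq_one_left ?_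
          rw [← map_mul, Units.inv_mul, map_one]
        rw [hinv, Matrix.det_apply]
        refine inv_mem ?_
        refine sum_mem fun τ _ => ?_
        rw [Units.smul_def]
        exact zsmul_mem (prod_mem fun i _ => hYmem _ _) _
    exact fun r => hle (Algebra.mem_top (x := r))
  have hsurj : Function.Surjective τ := by
    intro x
    obtain ⟨b, c, hc, rfl⟩ := IsFractionRing.div_surjective (A := R) x
    exact div_mem (hRmem b) (hRmem c)
  exact ⟨AlgEquiv.ofBijective τ ⟨τ.toRingHom.injective, hsurj⟩, hτd, hτ⟩

end PicardVessiotRings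

/-! ### Nilpotents in K ⊗ K -/

open scoped TensorProduct in
/-- In characteristic zero `a ⊗ 1 - 1 ⊗ a` is not nilpotent unless `a` lies in the base field. -/
theorem not_isNilpotent_tmul_one_sub_one_tmul {k K : Type*} [Field k] [CharZero k] [Field K]
    [Algebra k K] {a : K} (ha : a ∉ (algebraMap k K).range) :
    ¬ IsNilpotent (a ⊗ₜ[k] (1 : K) - (1 : K) ⊗ₜ[k] a) := by
  intro hnil
  let φ : (K →ₗ[k] k) → (K ⊗[k] K →ₗ[k] K) := fun f =>
    TensorProduct.lift ((LinearMap.lsmul k K).comp f)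
  have hφ : ∀ f x y, φ f (x ⊗ₜ y) = f x • y := fun f x y => rfl
  by_cases halg : IsAlgebraic k a
  · have hint := halg.isIntegral
    have hl : ∀ p : k[X], aeval (a ⊗ₜ[k] (1 : K)) p = aeval a p ⊗ₜ[k] (1 : K) := fun p =>
      aeval_algHom_apply (Algebra.TensorProduct.includeLeft : K →ₐ[k] K ⊗[k] K) a p
    have hr : ∀ p : k[X], aeval ((1 : K) ⊗ₜ[k] a) p = (1 : K) ⊗ₜ[k] aeval a p := fun p =>
      aeval_algHom_apply (Algebra.TensorProduct.includeRight : K →ₐ[k] K ⊗[k] K) a p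
    have h0 : aeval (a ⊗ₜ[k] (1 : K)) (minpoly k a) = 0 := by
      rw [hl, minpoly.aeval, TensorProduct.zero_tmul]
    have h1 : IsUnit (aeval (a ⊗ₜ[k] (1 : K)) (derivative (minpoly k a))) := by
      rw [hl]
      refine (IsUnit.mk0 _ ?_).map (Algebra.TensorProduct.includeLeft : K →ₐ[k] K ⊗[k] K)
      exact (minpoly.irreducible hint).separable.aeval_derivative_ne_zero (minpoly.aeval k a)
    -- Both a⊗1 and 1⊗a are roots of the separable minimal polynomial. Roots differing by a
    -- nilpotent coincide, by uniqueness in Newton's method. A functional with f(1) = 1 then gives a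
    -- = f(a) ∈ k.
    have heq := (existsUnique_nilpotent_sub_and_aeval_eq_zero (h0 ▸ IsNilpotent.zero) h1).unique
      (y₁ := a ⊗ₜ[k] (1 : K)) (y₂ := (1 : K) ⊗ₜ[k] a) ⟨by simp, h0⟩
      ⟨hnil, by rw [hr, minpoly.aeval, TensorProduct.tmul_zero]⟩
    obtain ⟨f, hf⟩ := Module.Projective.exists_dual_eq_one k (one_ne_zero : (1 : K) ≠ 0)
    have := congrArg (φ f) heq
    rw [hφ, hφ, hf, one_smul, Algebra.smul_def, mul_one] at this
    exact ha ⟨f a, this⟩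
  · obtain ⟨m, hm⟩ := hnil
    have hinj : LinearMap.ker (aeval a : k[X] →ₐ[k] K).toLinearMap = ⊥ :=
      LinearMap.ker_eq_bot.mpr (transcendental_iff_injective.mp halg)
    obtain ⟨g, hg⟩ := (aeval a : k[X] →ₐ[k] K).toLinearMap.exists_leftInverse_of_injective hinj
    have hgp : ∀ i : ℕ, g (a ^ i) = X ^ i := fun i => by
      simpa using LinearMap.congr_fun hg (X ^ i)
    -- The powers of a are independent, and this functional sends 1 to 1 and the positive powers to
    -- 0. Contracting the binomial expansion leaves only (−a)^m.
    have h := congrArg (φ (lcoeff k 0 ∘ₗ g)) hm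
    have hterm : ∀ i : ℕ, (a ⊗ₜ[k] (1 : K)) ^ i * (-((1 : K) ⊗ₜ[k] a)) ^ (m - i) *
        (m.choose i : K ⊗[k] K) = (a ^ i) ⊗ₜ[k] ((-a) ^ (m - i) * (m.choose i : K)) := by
      intro i
      rw [← TensorProduct.tmul_neg, Algebra.TensorProduct.tmul_pow,
        Algebra.TensorProduct.tmul_pow, Algebra.TensorProduct.tmul_mul_tmul, one_pow, one_pow,
        mul_one, one_mul, ← nsmul_eq_mul', ← nsmul_eq_mul', TensorProduct.tmul_smul]
    rw [sub_eq_add_neg, add_pow, map_zero, map_sum, Finset.sum_eq_single 0] at h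
    · rw [hterm, hφ, LinearMap.comp_apply, hgp] at h
      simp only [pow_zero, lcoeff_apply, coeff_one_zero, one_smul, tsub_zero, Nat.choose_zero_right,
        Nat.cast_one, mul_one] at h
      have ha0 : a = 0 := by simpa using eq_zero_of_pow_eq_zero h
      exact ha ⟨0, by rw [ha0, map_zero]⟩
    · intro i _ hi
      rw [hterm, hφ, LinearMap.comp_apply, hgp, lcoeff_apply, coeff_X_pow, if_neg hi.symm,
        zero_smul]
    · simp

/-! ### The derivation on a tensor product -/

section TensorDerivation

open scoped TensorProduct

variable {k : Type*} [Field k] [Differential k] {K : Type*} [CommRing K] [Differential K]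
  [Algebra k K] [DifferentialAlgebra k K] {R : Type*} [CommRing R] [Differential R] [Algebra k R]
  [DifferentialAlgebra k R]

theorem Differential.deriv_algebra_smul (a : k) (x : K) : (a • x)′ = (a′) • x + a • x′ := by
  rw [Algebra.smul_def, Derivation.leibniz, deriv_algebraMap, smul_eq_mul, smul_eq_mul,
    Algebra.smul_def, Algebra.smul_def, add_comm, mul_comm x]

variable (k K R) in
/-- The additive map `x ⊗ y ↦ x′ ⊗ y + x ⊗ y′`. -/
noncomputable def tensorDeriv : K ⊗[k] R →+ K ⊗[k] R :=
  -- The map is additive but not k-linear. It is balanced because moving a scalar a across the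
  -- tensor sign produces the same extra term a′x⊗y on either side.
  TensorProduct.liftAddHom
    (AddMonoidHom.mk' (fun x => AddMonoidHom.mk' (fun y => (x′) ⊗ₜ[k] y + x ⊗ₜ[k] (y′)) (by
      intro y z
      rw [map_add, TensorProduct.tmul_add, TensorProduct.tmul_add]
      abel)) (by
      intro x z
      ext y
      simp only [AddMonoidHom.mk'_apply, AddMonoidHom.add_apply, map_add, TensorProduct.add_tmul]
      abel))
    (by
      intro a x y
      simp only [AddMonoidHom.mk'_apply, Differential.deriv_algebra_smul, TensorProduct.add_tmul,
        TensorProduct.tmul_add, TensorProduct.smul_tmul]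
      abel)

/-- The derivation `x ⊗ y ↦ x′ ⊗ y + x ⊗ y′` on a tensor product. -/
@[reducible]
noncomputable def tensorDifferential : Differential (K ⊗[k] R) where
  deriv := Derivation.mk' (tensorDeriv k K R).toIntLinearMap (by
    intro s t
    have htmul : ∀ (x : K) (y : R), tensorDeriv k K R (x ⊗ₜ y) = (x′) ⊗ₜ y + x ⊗ₜ (y′) :=
      fun _ _ => rfl
    simp only [AddMonoidHom.coe_toIntLinearMap, smul_eq_mul]
    induction s using TensorProduct.induction_on with
    | zero => simp
    | add s₁ s₂ h₁ h₂ =>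
      rw [add_mul, map_add, h₁, h₂, map_add]
      ring
    | tmul x y =>
      induction t using TensorProduct.induction_on with
      | zero => simp
      | add t₁ t₂ h₁ h₂ =>
        rw [mul_add, map_add, h₁, h₂, map_add]
        ring
      | tmul z w =>
        simp only [Algebra.TensorProduct.tmul_mul_tmul, htmul, Derivation.leibniz,
          smul_eq_mul, mul_add, TensorProduct.add_tmul, TensorProduct.tmul_add, mul_comm z,
          mul_comm w]
        abel)

end TensorDerivation

/-! ### The fixed field of the Galois group -/

section FixedField

open scoped TensorProduct

variable {k : Type*} [Field k] [CharZero k] [Differential k] {n : ℕ}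
  {A : Matrix (Fin n) (Fin n) k}
  {R : Type*} [CommRing R] [Differential R] [Algebra k R] [DifferentialAlgebra k R]
  {K : Type*} [Field K] [Differential K] [Algebra k K] [DifferentialAlgebra k K]
  [Algebra R K] [DifferentialAlgebra R K] [IsScalarTower k R K] [IsFractionRing R K]

/-- The differential Galois group of a Picard-Vessiot field has fixed field `k`. -/
theorem IsPVRing.mem_range_of_forall_mem_DGal [IsAlgClosed (fieldOfConstants k)]
    (h : IsPVRing A R) {a : K} (ha : ∀ τ ∈ DGal k K, τ a = a) : a ∈ (algebraMap k K).range := by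
  by_contra hak
  have hCK := h.constants_iff (K := K)
  have hft := h.finiteType
  have := h.1.1
  obtain ⟨b, c, hc, hbc⟩ := IsFractionRing.div_surjective (A := R) a
  have hc0 : algebraMap R K c ≠ 0 := IsFractionRing.to_map_ne_zero_of_mem_nonZeroDivisors hc
  have hbc' : algebraMap R K b = a * algebraMap R K c := by rw [← hbc, div_mul_cancel₀ _ hc0]
  let : Differential (K ⊗[k] R) := tensorDifferential
  have htm : ∀ (x : K) (y : R), (x ⊗ₜ[k] y)′ = (x′) ⊗ₜ y + x ⊗ₜ (y′) := fun x y => rfl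
  obtain ⟨d, hd⟩ : ∃ d : K ⊗[k] R, d = a ⊗ₜ c - 1 ⊗ₜ b := ⟨_, rfl⟩
  have hdn : ¬ IsNilpotent d := by
    intro hdn
    have h1 := hdn.map (Algebra.TensorProduct.map (AlgHom.id k K) (IsScalarTower.toAlgHom k R K))
    have h2 : Algebra.TensorProduct.map (AlgHom.id k K) (IsScalarTower.toAlgHom k R K) d =
        (a ⊗ₜ[k] (1 : K) - (1 : K) ⊗ₜ[k] a) * (1 : K) ⊗ₜ[k] algebraMap R K c := by
      rw [hd, map_sub, Algebra.TensorProduct.map_tmul, Algebra.TensorProduct.map_tmul, sub_mul,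
        Algebra.TensorProduct.tmul_mul_tmul, Algebra.TensorProduct.tmul_mul_tmul]
      simp [hbc']
    have h3 := (Commute.all _ ((1 : K) ⊗ₜ[k] (algebraMap R K c)⁻¹)).isNilpotent_mul_right h1
    rw [h2, mul_assoc, Algebra.TensorProduct.tmul_mul_tmul, mul_one, mul_inv_cancel₀ hc0,
      ← Algebra.TensorProduct.one_def, mul_one] at h3
    exact not_isNilpotent_tmul_one_sub_one_tmul hak h3
  -- X is to become 1/d, whose derivative is −d′/d². With this choice (dX − 1)′ = −d′X(dX − 1), so
  -- dX − 1 generates a differential ideal.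
  let : Differential (K ⊗[k] R)[X] := ⟨Differential.implicitDeriv (-(C (d′) * X ^ 2))⟩
  have hDC : ∀ s : K ⊗[k] R, (C s)′ = C (s′) := fun s => Differential.implicitDeriv_C _ s
  have hDX : (X : (K ⊗[k] R)[X])′ = -(C (d′) * X ^ 2) := Differential.implicitDeriv_X _
  have : DifferentialAlgebra K (K ⊗[k] R)[X] := by
    refine ⟨fun x => ?_⟩
    change (C (x ⊗ₜ[k] (1 : R)))′ = C ((x′) ⊗ₜ[k] (1 : R))
    rw [hDC, htm]
    simp
  have : Algebra.FiniteType K (K ⊗[k] R)[X] :=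
    Algebra.FiniteType.trans (S := K ⊗[k] R) inferInstance inferInstance
  set I : Ideal (K ⊗[k] R)[X] := Ideal.span {C d * X - 1} with hI
  have hId : I.IsDifferential := by
    have hbot : (⊥ : Ideal (K ⊗[k] R)[X]).IsDifferential := by
      intro x hx
      rw [(Submodule.mem_bot _).mp hx, map_zero]
      exact zero_mem _
    rw [hI, ← bot_sup_eq (Ideal.span _)]
    refine hbot.sup_span_singleton (Ideal.mem_sup_right (Ideal.mem_span_singleton'.mpr
      ⟨-(C (d′) * X), ?_⟩))
    rw [map_sub, Derivation.leibniz, hDC, hDX, Derivation.map_one_eq_zero, smul_eq_mul,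
      smul_eq_mul]
    ring
  have hItop : I ≠ ⊤ := by
    rw [hI, Ne, Ideal.span_singleton_eq_top]
    intro hu
    -- A unit polynomial has nilpotent higher coefficients, but the coefficient of X is d.
    have h1 := ((isUnit_iff_coeff_isUnit_isNilpotent).mp hu).2 1 one_ne_zero
    rw [coeff_sub, coeff_C_mul, coeff_X_one, coeff_one, if_neg one_ne_zero, mul_one,
      sub_zero] at h1
    exact hdn h1
  obtain ⟨P, hIP, hP⟩ := hId.exists_le_isMaximalDifferential hItop
  let ζ : R →ₐ[k] (K ⊗[k] R)[X] := (IsScalarTower.toAlgHom k (K ⊗[k] R) (K ⊗[k] R)[X]).comp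
    Algebra.TensorProduct.includeRight
  have hζC : ∀ r, ζ r = C ((1 : K) ⊗ₜ[k] r) := fun r => rfl
  obtain ⟨σ, hσ, hσP⟩ := h.exists_algHom_of_isMaximalDifferential hCK hP ζ (by
    intro r
    rw [hζC, hζC, hDC, htm]
    simp)
  obtain ⟨τ, hτ, hτσ⟩ := h.exists_mem_DGal σ hσ
  have heq : σ b = a * σ c := by rw [← hτσ, ← hτσ, hbc', map_mul, ha τ hτ]
  -- Modulo P, d is aσ(c) − σ(b), which vanishes when a is fixed. Together with dX − 1 ∈ P this
  -- gives 1 ∈ P.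
  have hdP : C d ∈ P := by
    have h1 : C d = algebraMap K (K ⊗[k] R)[X] a * (ζ c - algebraMap K _ (σ c)) -
        (ζ b - algebraMap K _ (σ b)) := by
      have h2 : C (a ⊗ₜ[k] c) = algebraMap K (K ⊗[k] R)[X] a * ζ c := by
        rw [hζC]
        change _ = C (a ⊗ₜ[k] (1 : R)) * _
        rw [← C_mul, Algebra.TensorProduct.tmul_mul_tmul, mul_one, one_mul]
      rw [hd, C_sub, h2, ← hζC, heq, map_mul]
      ring
    rw [h1]
    exact sub_mem (Ideal.mul_mem_left _ _ (hσP c)) (hσP b)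
  refine hP.prop.2 ((Ideal.eq_top_iff_one _).mpr ?_)
  have h1 := sub_mem (Ideal.mul_mem_right X _ hdP) (hIP (Ideal.mem_span_singleton_self _))
  rwa [sub_sub_cancel] at h1

end FixedField

namespace DiffOp

/-! ### Left ideals of k[∂] and the correspondence with submodules -/

section LeftIdeals

variable {k : Type*} [Field k] [Differential k]

theorem exists_mul_monic {M : DiffOp k} (hM : M ≠ 0) :
    ∃ c : DiffOp k, (c * M).Monic ∧ (c * M).ord = M.ord := by
  have h := coeff_mul_of_ord_le (L := const (M.coeff M.ord)⁻¹) (l := 0)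
    (natDegree_C _).le (le_refl M.ord)
  have h1 : (const (M.coeff M.ord)⁻¹ * M).coeff M.ord = 1 := by
    have h2 := h.2
    rw [zero_add] at h2
    rw [h2, show (const (M.coeff M.ord)⁻¹).coeff 0 = (M.coeff M.ord)⁻¹ from coeff_C_zero]
    exact inv_mul_cancel₀ (coeff_ord_ne_zero hM)
  have hord : (const (M.coeff M.ord)⁻¹ * M).ord = M.ord :=
    ord_eq_of_coeff (fun i hi => coeff_eq_zero_of_ord_lt (h.1.trans_lt (by omega)))
      (by rw [h1]; exact one_ne_zero)
  refine ⟨_, ?_, hord⟩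
  change (const (M.coeff M.ord)⁻¹ * M).coeff (const (M.coeff M.ord)⁻¹ * M).ord = 1
  rw [hord, h1]

theorem Monic.eq_zero_of_mul_coeff {M : DiffOp k} (hM : M.Monic) {Q : DiffOp k}
    (h : ∀ i, M.ord ≤ i → (Q * M).coeff i = 0) : Q * M = 0 := by
  by_contra h0
  have hQ : Q ≠ 0 := by
    rintro rfl
    exact h0 (zero_mul M)
  have := ord_lt_of_coeff h0 h
  rw [ord_mul hQ hM.ne_zero] at this
  omega

/-- Mutual divisibility forces equal orders, so M − N is a left multiple of N of smaller order,
hence zero. -/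
theorem Monic.eq_of_span_eq {M N : DiffOp k} (hM : M.Monic) (hN : N.Monic)
    (h : Submodule.span (DiffOp k) {M} = Submodule.span (DiffOp k) {N}) : M = N := by
  have key : ∀ {M N : DiffOp k}, M.Monic → N.Monic → M ∈ Submodule.span (DiffOp k) {N} →
      N.ord ≤ M.ord := by
    intro M N hM hN h
    obtain ⟨Q, rfl⟩ := Submodule.mem_span_singleton.mp h
    have hQ : Q ≠ 0 := by
      rintro rfl
      exact hM.ne_zero (zero_smul _ N)
    rw [smul_eq_mul, ord_mul hQ hN.ne_zero]
    exact Nat.le_add_left _ _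
  have hMN : M ∈ Submodule.span (DiffOp k) {N} := h ▸ Submodule.mem_span_singleton_self M
  have hNM : N ∈ Submodule.span (DiffOp k) {M} := h ▸ Submodule.mem_span_singleton_self N
  have hord : M.ord = N.ord := le_antisymm (key hN hM hNM) (key hM hN hMN)
  obtain ⟨Q, hQ⟩ := Submodule.mem_span_singleton.mp
    (sub_mem hMN (Submodule.mem_span_singleton_self N))
  rw [← sub_eq_zero, ← hQ]
  exact hN.eq_zero_of_mul_coeff fun i hi =>
    (congrArg (coeff · i) hQ).trans (hM.coeff_sub_eq_zero hN hord hi)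

/-- Every nonzero left ideal of `k[∂]` is generated by a monic operator. -/
theorem exists_monic_span_eq {I : Submodule (DiffOp k) (DiffOp k)} {L : DiffOp k} (hL : L ≠ 0)
    (hLI : L ∈ I) : ∃ M : DiffOp k, M.Monic ∧ Submodule.span (DiffOp k) {M} = I := by
  classical
  -- The generator is a monic element of least order: a nonzero remainder, once made monic, would
  -- have smaller order.
  have hex : ∃ n, ∃ M ∈ I, M.Monic ∧ M.ord = n := by
    obtain ⟨c, hc, -⟩ := exists_mul_monic hL
    exact ⟨_, c * L, I.smul_mem c hLI, hc, rfl⟩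
  obtain ⟨M, hMI, hM, hord⟩ := Nat.find_spec hex
  refine ⟨M, hM, le_antisymm ((Submodule.span_singleton_le_iff_mem _ _).mpr hMI) fun P hP => ?_⟩
  obtain ⟨Q, R, hQR, hR⟩ := hM.exists_eq_mul_add P
  have hR0 : R = 0 := by
    by_contra hR0
    have hRI : R ∈ I := by
      rw [← add_sub_cancel_left (Q * M) R, ← hQR]
      exact sub_mem hP (I.smul_mem Q hMI)
    obtain ⟨c, hc, hc'⟩ := exists_mul_monic hR0
    have := Nat.find_min' hex ⟨c * R, I.smul_mem c hRI, hc, rfl⟩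
    have := ord_lt_of_coeff hR0 hR
    omega
  rw [hQR, hR0, add_zero]
  exact Submodule.mem_span_singleton.mpr ⟨Q, rfl⟩

/-- Monic right factors of `L` correspond to the submodules of `k[∂] / k[∂]L`. -/
theorem bijOn_span_map_mkQ {L : DiffOp k} (hL : L ≠ 0) :
    Set.BijOn
      (fun L₀ : DiffOp k =>
        (Submodule.span (DiffOp k) {L₀}).map (Submodule.span (DiffOp k) {L}).mkQ)
      L.monicRightFactors
      (Set.univ : Set (Submodule (DiffOp k) (DiffOp k ⧸ Submodule.span (DiffOp k) {L}))) := by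
  have hle : ∀ L₀ ∈ L.monicRightFactors,
      Submodule.span (DiffOp k) {L} ≤ Submodule.span (DiffOp k) {L₀} := by
    rintro L₀ ⟨-, L₁, rfl⟩
    rw [Submodule.span_singleton_le_iff_mem]
    exact Submodule.mem_span_singleton.mpr ⟨L₁, rfl⟩
  refine ⟨fun _ _ => Set.mem_univ _, fun M hM N hN hMN => ?_, fun N _ => ?_⟩
  · refine hM.1.eq_of_span_eq hN.1 ?_
    have := congrArg (Submodule.comap (Submodule.span (DiffOp k) {L}).mkQ) hMN
    simpa only [Submodule.comap_map_mkQ, sup_eq_right.mpr (hle M hM),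
      sup_eq_right.mpr (hle N hN)] using this
  · have hLN : L ∈ N.comap (Submodule.span (DiffOp k) {L}).mkQ := by
      rw [Submodule.mem_comap, Submodule.mkQ_apply, (Submodule.Quotient.mk_eq_zero _).mpr
        (Submodule.mem_span_singleton_self L)]
      exact zero_mem N
    obtain ⟨M, hM, hspan⟩ := exists_monic_span_eq hL hLN
    refine ⟨M, ⟨hM, ?_⟩, ?_⟩
    · rw [← hspan] at hLN
      obtain ⟨Q, hQ⟩ := Submodule.mem_span_singleton.mp hLN
      exact ⟨Q, hQ.symm⟩
    · change Submodule.map _ _ = N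
      rw [hspan, Submodule.map_comap_eq, Submodule.range_mkQ, top_inf_eq]

end LeftIdeals

/-! ### Extension of coefficients and the Galois action -/

section BaseChange

variable {k K : Type*} [Field k] [Field K] [Algebra k K]

theorem coeff_map (L : DiffOp k) (i : ℕ) : (L.map K).coeff i = algebraMap k K (L.coeff i) :=
  Polynomial.coeff_map _ _

theorem ord_map (L : DiffOp k) : (L.map K).ord = L.ord :=
  natDegree_map_eq_of_injective (algebraMap k K).injective (toPoly L)

theorem map_injective : Function.Injective (map K : DiffOp k → DiffOp K) :=
  Polynomial.map_injective _ (algebraMap k K).injective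

theorem map_ne_zero {L : DiffOp k} (hL : L ≠ 0) : L.map K ≠ 0 := fun h =>
  hL (map_injective (h.trans (Polynomial.map_zero (algebraMap k K)).symm))

variable [Differential K]

theorem iterate_deriv_apply_of_mem_DGal {σ : K ≃ₐ[k] K} (hσ : σ ∈ DGal k K) (i : ℕ) (y : K) :
    (fun z : K => z′)^[i] (σ y) = σ ((fun z : K => z′)^[i] y) := by
  induction i with
  | zero => rfl
  | succ i ih => rw [Function.iterate_succ_apply', Function.iterate_succ_apply', ih, hσ]

theorem eval_apply_of_mem_DGal {σ : K ≃ₐ[k] K} (hσ : σ ∈ DGal k K) (L : DiffOp k) (y : K) :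
    L.eval (σ y) = σ (L.eval y) := by
  simp only [eval, sum_def, map_sum, map_mul, AlgEquiv.commutes,
    iterate_deriv_apply_of_mem_DGal hσ]

theorem eval_ofPoly_map_of_mem_DGal {σ : K ≃ₐ[k] K} (hσ : σ ∈ DGal k K) (P : DiffOp K) (y : K) :
    (ofPoly ((toPoly P).map (σ : K →+* K))).eval (σ y) = σ (P.eval y) := by
  change Polynomial.sum ((toPoly P).map (σ : K →+* K)) _ = _
  rw [sum_over_range' _ (by simp) (P.ord + 1) (Nat.lt_succ_of_le natDegree_map_le),
    eval_eq_sum (n := P.ord + 1) fun i hi => coeff_eq_zero_of_ord_lt hi, map_sum]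
  refine Finset.sum_congr rfl fun i _ => ?_
  rw [Polynomial.coeff_map, iterate_deriv_apply_of_mem_DGal hσ, map_mul]
  rfl

end BaseChange

/-! ### Solution spaces in the absence of new constants -/

section Constants

universe u v

variable {k : Type u} {K : Type v} [Field k] [Differential k] [Field K] [Differential K]
  [Algebra k K]

variable (k K) in
/-- Every constant of `K` lies in `k`. -/
def NoNewConstants : Prop :=
  ∀ x : K, x′ = 0 ↔ x ∈ (algebraMap (fieldOfConstants k) K).range

theorem NoNewConstants.deriv_eq_zero (h : NoNewConstants k K) (c : fieldOfConstants k) :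
    (algebraMap (fieldOfConstants k) K c)′ = 0 := (h _).mpr ⟨c, rfl⟩

/-- The dimension bound in the form that gives all uniqueness statements below: P is a difference of
monic operators, a remainder, or a relation between the rows of a Wronskian matrix. -/
theorem eq_zero_of_forall_eval_eq_zero (h : NoNewConstants k K) {P : DiffOp K} {n : ℕ}
    (hP : ∀ i, n ≤ i → P.coeff i = 0) {W : Submodule (fieldOfConstants k) K}
    (hW : (n : Cardinal) ≤ Module.rank (fieldOfConstants k) W) (hPW : ∀ w ∈ W, P.eval w = 0) :
    P = 0 := by
  by_contra hP0
  have hle : W ≤ LinearMap.ker (P.evalLinear h.deriv_eq_zero) := hPW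
  have h1 := hW.trans ((Submodule.rank_mono hle).trans (rank_ker_evalLinear_le h hP0))
  exact (ord_lt_of_coeff hP0 hP).not_ge (by exact_mod_cast h1)

/-- A monic operator over `K` is determined by its solutions; hence it is fixed by the Galois group
if these form an invariant subspace. -/
theorem Monic.apply_coeff_eq_of_mem_DGal (h : NoNewConstants k K) {P : DiffOp K} (hP : P.Monic)
    {W : Submodule (fieldOfConstants k) K} (hPW : ∀ w ∈ W, P.eval w = 0)
    (hrank : (P.ord : Cardinal) ≤ Module.rank (fieldOfConstants k) W)
    (hW : ∀ σ ∈ DGal k K, ∀ w ∈ W, σ w ∈ W) {σ : K ≃ₐ[k] K} (hσ : σ ∈ DGal k K) (i : ℕ) :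
    σ (P.coeff i) = P.coeff i := by
  set Q : DiffOp K := ofPoly ((toPoly P).map (σ : K →+* K)) with hQ
  have hQm : Q.Monic := Polynomial.Monic.map (p := toPoly P) (σ : K →+* K) hP
  have hQord : Q.ord = P.ord :=
    natDegree_map_eq_of_injective (f := (σ : K →+* K)) σ.injective (toPoly P)
  -- σ(P) is monic of the same order and kills σ(W). Invariance under σ⁻¹ makes it kill W, on which
  -- P vanishes too, and the difference has smaller order.
  have h0 : Q - P = 0 := by
    refine eq_zero_of_forall_eval_eq_zero h (fun i hi => hQm.coeff_sub_eq_zero hP hQord hi)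
      hrank fun w hw => ?_
    have h1 : Q.eval (σ (σ⁻¹ w)) = σ (P.eval (σ⁻¹ w)) := eval_ofPoly_map_of_mem_DGal hσ P _
    rw [hPW _ (hW _ (inv_mem hσ) w hw), map_zero,
      show σ (σ⁻¹ w) = w from σ.apply_symm_apply w] at h1
    rw [eval_sub_left, h1, hPW w hw, sub_zero]
  have h2 : Q.coeff i = σ (P.coeff i) := Polynomial.coeff_map _ _
  rw [← h2, sub_eq_zero.mp h0]

variable [DifferentialAlgebra k K]

theorem ker_evalLinear (h : NoNewConstants k K) (L : DiffOp k) :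
    LinearMap.ker (L.evalLinear (K := K) h.deriv_eq_zero) = L.solutionSpace K := rfl

theorem ker_evalLinear_map (h : NoNewConstants k K) (L : DiffOp k) :
    LinearMap.ker ((L.map K).evalLinear h.deriv_eq_zero) = L.solutionSpace K := by
  ext y
  exact (Eq.congr_left (L.eval_map y))

theorem rank_solutionSpace_le (h : NoNewConstants k K) {L : DiffOp k} (hL : L ≠ 0) :
    Module.rank (fieldOfConstants k) (L.solutionSpace K) ≤ (L.ord : Cardinal) := by
  rw [← ker_evalLinear_map h, ← ord_map (K := K)]
  exact rank_ker_evalLinear_le h (map_ne_zero hL)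

theorem mul_solutionSpace_le (L₁ L₀ : DiffOp k) :
    L₀.solutionSpace K ≤ (L₁ * L₀).solutionSpace K := by
  intro y (hy : L₀.eval y = 0)
  change (L₁ * L₀).eval y = 0
  rw [eval_mul, hy]
  simpa using eval_add_right L₁ (0 : K) 0

/-- If `L` has a full solution space, then so does each of its right factors. -/
theorem rank_solutionSpace_of_mul (h : NoNewConstants k K) {L₁ L₀ : DiffOp k}
    (hL : L₁ * L₀ ≠ 0) (hrank : ((L₁ * L₀).ord : Cardinal) ≤
      Module.rank (fieldOfConstants k) ((L₁ * L₀).solutionSpace K)) :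
    Module.rank (fieldOfConstants k) (L₀.solutionSpace K) = (L₀.ord : Cardinal) := by
  have h₁ : L₁ ≠ 0 := left_ne_zero_of_mul hL
  have h₀ : L₀ ≠ 0 := right_ne_zero_of_mul hL
  have hcomp : (L₁ * L₀).evalLinear (K := K) h.deriv_eq_zero =
      L₁.evalLinear (K := K) h.deriv_eq_zero ∘ₗ L₀.evalLinear (K := K) h.deriv_eq_zero :=
    LinearMap.ext fun y => eval_mul L₁ L₀ y
  -- Each factor contributes at most its order, and the orders add up to that of the product, so no
  -- inequality can be strict.
  have hadd := LinearMap.rank_ker_comp_le (L₁.evalLinear (K := K) h.deriv_eq_zero)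
    (L₀.evalLinear (K := K) h.deriv_eq_zero)
  rw [← hcomp, ker_evalLinear h, ker_evalLinear h, ker_evalLinear h] at hadd
  replace hadd := hrank.trans hadd
  rw [ord_mul h₁ h₀] at hadd
  obtain ⟨r₁, hr₁⟩ := Cardinal.exists_nat_eq_of_le_nat (rank_solutionSpace_le (K := K) h h₁)
  obtain ⟨r₀, hr₀⟩ := Cardinal.exists_nat_eq_of_le_nat (rank_solutionSpace_le (K := K) h h₀)
  rw [hr₁.2, hr₀.2] at hadd
  have hadd' : L₁.ord + L₀.ord ≤ r₁ + r₀ := by exact_mod_cast hadd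
  rw [hr₀.2]
  have := hr₁.1
  have := hr₀.1
  exact_mod_cast (by omega : r₀ = L₀.ord)

end Constants

/-! ### The Wronskian operator -/

section Wronskian

variable {K : Type*} [Field K] {t : ℕ}

/-- Laplace expansion along the last column. The same minors occur when wr(b₁, …, b_t, y) is
expanded, which identifies it with a value of the operator. -/
theorem det_snoc_X_pow (m : Fin (t + 1) → Fin t → K) :
    (Matrix.of fun i : Fin (t + 1) =>
      Fin.snoc (α := fun _ => K[X]) (fun j : Fin t => C (m i j)) (X ^ (i : ℕ))).det =
    ∑ i : Fin (t + 1), C ((-1) ^ ((i : ℕ) + t) *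
      (Matrix.of fun r j : Fin t => m (i.succAbove r) j).det) * X ^ (i : ℕ) := by
  rw [Matrix.det_succ_column _ (Fin.last t)]
  refine Finset.sum_congr rfl fun i _ => ?_
  have : ((Matrix.of fun i : Fin (t + 1) =>
      Fin.snoc (α := fun _ => K[X]) (fun j : Fin t => C (m i j)) (X ^ (i : ℕ))).submatrix
        i.succAbove (Fin.last t).succAbove) =
      (Matrix.of fun r j : Fin t => m (i.succAbove r) j).map (C : K →+* K[X]) := by
    ext1 r j
    simp
  rw [this, ← RingHom.mapMatrix_apply, ← RingHom.map_det]
  simp only [Matrix.of_apply, Fin.snoc_last, Fin.val_last, map_mul, map_pow, map_neg, map_one]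
  ring

variable [Differential K]

theorem wronskianOperator_eq_sum (b : Fin t → K) :
    wronskianOperator b = ofPoly (C (wronskianDet b)⁻¹ *
      ∑ i : Fin (t + 1), C ((-1) ^ ((i : ℕ) + t) *
        (Matrix.of fun r j : Fin t => (fun z : K => z′)^[(i.succAbove r : ℕ)] (b j)).det) *
          X ^ (i : ℕ)) := by
  rw [wronskianOperator, det_snoc_X_pow]

theorem coeff_wronskianOperator (b : Fin t → K) (i : Fin (t + 1)) :
    (wronskianOperator b).coeff i = (wronskianDet b)⁻¹ * ((-1) ^ ((i : ℕ) + t) *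
      (Matrix.of fun r j : Fin t => (fun z : K => z′)^[(i.succAbove r : ℕ)] (b j)).det) := by
  rw [wronskianOperator_eq_sum, coeff_ofPoly, coeff_C_mul, finsetSum_coeff]
  simp only [coeff_C_mul_X_pow, Fin.val_inj]
  simp

theorem coeff_wronskianOperator_of_lt (b : Fin t → K) {i : ℕ} (hi : t < i) :
    (wronskianOperator b).coeff i = 0 := by
  rw [wronskianOperator_eq_sum, coeff_ofPoly, coeff_C_mul, finsetSum_coeff, Finset.sum_eq_zero,
    mul_zero]
  intro j _
  rw [coeff_C_mul_X_pow, if_neg (by omega)]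

theorem wronskianOperator_monic {b : Fin t → K} (hb : wronskianDet b ≠ 0) :
    (wronskianOperator b).Monic ∧ (wronskianOperator b).ord = t := by
  have h : (wronskianOperator b).coeff t = 1 := by
    have := coeff_wronskianOperator b (Fin.last t)
    rw [Fin.val_last] at this
    -- The last cofactor has sign (−1)^(2t), and deleting the last row leaves wr(b) itself.
    rw [this, ← two_mul, pow_mul, neg_one_sq, one_pow, one_mul]
    simp only [Fin.succAbove_last, Fin.val_castSucc]
    exact inv_mul_cancel₀ hb
  have hord : (wronskianOperator b).ord = t :=
    ord_eq_of_coeff (fun i hi => coeff_wronskianOperator_of_lt b hi) (by rw [h]; exact one_ne_zero)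
  refine ⟨?_, hord⟩
  change (wronskianOperator b).coeff (wronskianOperator b).ord = 1
  rw [hord, h]

theorem eval_wronskianOperator (b : Fin t → K) (y : K) :
    (wronskianOperator b).eval y = (wronskianDet b)⁻¹ *
      wronskianDet (Fin.snoc (α := fun _ => K) b y) := by
  rw [eval_eq_sum (n := t + 1) (fun i hi => coeff_wronskianOperator_of_lt b (by omega)),
    Finset.sum_range, wronskianDet.eq_def (Fin.snoc (α := fun _ => K) b y),
    Matrix.det_succ_column _ (Fin.last t), Finset.mul_sum]
  refine Finset.sum_congr rfl fun i _ => ?_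
  rw [coeff_wronskianOperator]
  have : ((Matrix.of fun i j : Fin (t + 1) => (fun z : K => z′)^[(i : ℕ)]
      (Fin.snoc (α := fun _ => K) b y j)).submatrix i.succAbove (Fin.last t).succAbove) =
      Matrix.of fun r j : Fin t => (fun z : K => z′)^[(i.succAbove r : ℕ)] (b j) := by
    ext1 r j
    simp
  rw [this]
  simp only [Matrix.of_apply, Fin.snoc_last, Fin.val_last, Algebra.algebraMap_self, RingHom.id_apply]
  ring

theorem eval_wronskianOperator_self (b : Fin t → K) (j : Fin t) :
    (wronskianOperator b).eval (b j) = 0 := by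
  rw [eval_wronskianOperator, wronskianDet.eq_def (Fin.snoc (α := fun _ => K) b (b j)),
    Matrix.det_zero_of_column_eq (i := j.castSucc) (j := Fin.last t) (Fin.castSucc_lt_last j).ne,
    mul_zero]
  intro i
  simp

end Wronskian

end DiffOp

namespace DiffOp

/-! ### Invariant subspaces and right factors -/

section InvariantSubspaces

variable {k K : Type*} [Field k] [Differential k] [Field K] [Differential K]
  [Algebra k K]

theorem _root_.Module.Basis.le_of_forall_mem {C V ι : Type*} [Ring C] [AddCommGroup V]
    [Module C V] {W N : Submodule C V} (b : Module.Basis ι C W) (h : ∀ i, (b i : V) ∈ N) :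
    W ≤ N := by
  have : ⊤ ≤ N.comap W.subtype := by
    rw [← b.span_eq, Submodule.span_le]
    rintro _ ⟨i, rfl⟩
    exact h i
  exact fun w hw => this (Submodule.mem_top (x := ⟨w, hw⟩))

theorem rank_eq_of_basis_fin {C V : Type*} [Field C] [AddCommGroup V] [Module C V] {t : ℕ}
    (b : Module.Basis (Fin t) C V) : Module.rank C V = t := by
  rw [rank_eq_card_basis b, Fintype.card_fin]

/-- The Wronskian of elements that are linearly independent over the constants is nonzero. -/
theorem wronskianDet_ne_zero (h : NoNewConstants k K) {W : Submodule (fieldOfConstants k) K}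
    {t : ℕ} (b : Module.Basis (Fin t) (fieldOfConstants k) W) :
    wronskianDet (fun j => (b j : K)) ≠ 0 := by
  intro h0
  obtain ⟨v, hv, hv0⟩ := Matrix.exists_vecMul_eq_zero_iff.mpr h0
  -- A linear relation between the rows of the Wronskian matrix is a nonzero operator with no terms
  -- of degree t or higher that kills every b_j. It would have t independent solutions.
  set P : DiffOp K := ofPoly (∑ i : Fin t, C (v i) * X ^ (i : ℕ)) with hP
  have hco : ∀ i : Fin t, P.coeff i = v i := by
    intro i
    change Polynomial.coeff (∑ i : Fin t, C (v i) * X ^ (i : ℕ)) i = v i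
    rw [finsetSum_coeff]
    simp only [coeff_C_mul_X_pow, Fin.val_inj]
    simp
  have hco' : ∀ i, t ≤ i → P.coeff i = 0 := by
    intro i hi
    change Polynomial.coeff (∑ i : Fin t, C (v i) * X ^ (i : ℕ)) i = 0
    rw [finsetSum_coeff, Finset.sum_eq_zero]
    intro j _
    rw [coeff_C_mul_X_pow, if_neg (by omega)]
  have hle : W ≤ LinearMap.ker (P.evalLinear h.deriv_eq_zero) := by
    refine b.le_of_forall_mem fun j => ?_
    change P.eval (b j : K) = 0
    rw [eval_eq_sum hco', Finset.sum_range]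
    have := congrFun hv0 j
    simpa only [hco, Matrix.vecMul, dotProduct, Matrix.of_apply, Pi.zero_apply,
      Algebra.algebraMap_self, RingHom.id_apply] using this
  have hP0 : P = 0 := eq_zero_of_forall_eval_eq_zero h hco'
    (rank_eq_of_basis_fin b).ge hle
  refine hv (funext fun i => ?_)
  rw [← hco, hP0]
  exact Polynomial.coeff_zero _

theorem eval_wronskianOperator_of_mem (h : NoNewConstants k K)
    {W : Submodule (fieldOfConstants k) K} {t : ℕ}
    (b : Module.Basis (Fin t) (fieldOfConstants k) W) {w : K} (hw : w ∈ W) :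
    (wronskianOperator fun j => (b j : K)).eval w = 0 := by
  have hle : W ≤ LinearMap.ker
      ((wronskianOperator fun j => (b j : K)).evalLinear h.deriv_eq_zero) :=
    b.le_of_forall_mem fun j => eval_wronskianOperator_self (fun j => (b j : K)) j
  exact hle hw

variable [DifferentialAlgebra k K]

/-- An operator over `k` that vanishes on the solutions of a monic operator `M`, where these
have full dimension, is divisible by `M` on the right. -/
theorem Monic.exists_eq_mul (h : NoNewConstants k K) {L M : DiffOp k} (hM : M.Monic)
    {W : Submodule (fieldOfConstants k) K}
    (hW : (M.ord : Cardinal) ≤ Module.rank (fieldOfConstants k) W)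
    (hMW : W ≤ M.solutionSpace K) (hLW : W ≤ L.solutionSpace K) : ∃ Q, L = Q * M := by
  obtain ⟨Q, R, hQR, hR⟩ := hM.exists_eq_mul_add L
  refine ⟨Q, ?_⟩
  have hR0 : R.map K = 0 := by
    refine eq_zero_of_forall_eval_eq_zero h (fun i hi => ?_) hW fun w hw => ?_
    · rw [coeff_map, hR i hi, map_zero]
    · have h1 : L.eval w = 0 := hLW hw
      have h2 : (Q * M).eval w = 0 := mul_solutionSpace_le Q M (hMW hw)
      rw [hQR, eval_add_left, h2, zero_add] at h1
      rw [eval_map, h1]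
  have : R = 0 := map_injective (hR0.trans (Polynomial.map_zero (algebraMap k K)).symm)
  rw [hQR, this, add_zero]

/-- An invariant subspace is the solution space of its Wronskian operator, which is defined
over `k`. -/
theorem exists_map_eq_wronskianOperator (h : NoNewConstants k K)
    (hfix : ∀ a : K, (∀ σ ∈ DGal k K, σ a = a) → a ∈ (algebraMap k K).range)
    {L : DiffOp k} {W : Submodule (fieldOfConstants k) K} (hW : W ∈ L.invariantSubspaces K)
    {t : ℕ} (b : Module.Basis (Fin t) (fieldOfConstants k) W) :
    (∀ σ ∈ DGal k K, ∀ i : ℕ, σ ((wronskianOperator fun j => (b j : K)).coeff i) =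
        (wronskianOperator fun j => (b j : K)).coeff i) ∧
      ∃ L₀ ∈ L.monicRightFactors, L₀.map K = wronskianOperator (fun j => (b j : K)) ∧
        L₀.solutionSpace K = W := by
  obtain ⟨hPm, hPord⟩ := wronskianOperator_monic (wronskianDet_ne_zero h b)
  have hPW : ∀ w ∈ W, (wronskianOperator fun j => (b j : K)).eval w = 0 :=
    fun w hw => eval_wronskianOperator_of_mem h b hw
  set P := wronskianOperator fun j => (b j : K) with hP
  have hrank : Module.rank (fieldOfConstants k) W = P.ord := by rw [hPord, rank_eq_of_basis_fin b]
  have hσ : ∀ σ ∈ DGal k K, ∀ i : ℕ, σ (P.coeff i) = P.coeff i := fun σ hσ i =>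
    hPm.apply_coeff_eq_of_mem_DGal h hPW hrank.ge hW.2 hσ i
  refine ⟨hσ, ?_⟩
  have hlift : toPoly P ∈ lifts (algebraMap k K) := by
    rw [lifts_iff_coeff_lifts]
    exact fun i => hfix _ fun σ hσ' => hσ σ hσ' i
  obtain ⟨q, hq, -, hqm⟩ := lifts_and_degree_eq_and_monic hlift hPm
  set L₀ : DiffOp k := ofPoly q with hL₀
  have hmap : L₀.map K = P := hq
  have hord : L₀.ord = P.ord := by rw [← hmap, ord_map]
  have hL₀m : L₀.Monic := hqm
  have hle : W ≤ L₀.solutionSpace K := by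
    intro w hw
    change L₀.eval w = 0
    rw [← eval_map, hmap, hPW w hw]
  -- Soln(L₀) contains W and has dimension at most ord L₀ = dim W.
  have heq : L₀.solutionSpace K = W := by
    have hub := rank_solutionSpace_le (K := K) h hL₀m.ne_zero
    have : Module.Finite (fieldOfConstants k) (L₀.solutionSpace K) :=
      Module.rank_lt_aleph0_iff.mp (hub.trans_lt Cardinal.natCast_lt_aleph0)
    refine (Submodule.eq_of_le_of_finrank_le hle ?_).symm
    rw [Module.finrank_eq_of_rank_eq hrank, ← hord]
    exact Module.finrank_le_of_rank_le hub
  exact ⟨L₀, ⟨hL₀m, hL₀m.exists_eq_mul h (by rw [hord, hrank]) hle hW.1⟩, hmap, heq⟩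

/-- Monic right factors of `L` correspond to the invariant subspaces of its solution space, if
this has full dimension. -/
theorem bijOn_solutionSpace (h : NoNewConstants k K)
    (hfix : ∀ a : K, (∀ σ ∈ DGal k K, σ a = a) → a ∈ (algebraMap k K).range)
    {L : DiffOp k} (hL : L ≠ 0)
    (hrank : (L.ord : Cardinal) ≤ Module.rank (fieldOfConstants k) (L.solutionSpace K)) :
    Set.BijOn (fun L₀ : DiffOp k => L₀.solutionSpace K)
      L.monicRightFactors (L.invariantSubspaces K) := by
  have hr : ∀ L₀ ∈ L.monicRightFactors,
      Module.rank (fieldOfConstants k) (L₀.solutionSpace K) = (L₀.ord : Cardinal) := by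
    rintro L₀ ⟨-, L₁, rfl⟩
    exact rank_solutionSpace_of_mul h hL hrank
  refine ⟨?_, fun M hM N hN hMN => ?_, fun W hW => ?_⟩
  · rintro L₀ ⟨-, L₁, rfl⟩
    refine ⟨mul_solutionSpace_le L₁ L₀, fun σ hσ w (hw : L₀.eval w = 0) => ?_⟩
    change L₀.eval (σ w) = 0
    rw [eval_apply_of_mem_DGal hσ, hw, map_zero]
  · change M.solutionSpace K = N.solutionSpace K at hMN
    have hord : M.ord = N.ord := by
      have := hr M hM
      rw [hMN, hr N hN] at this
      exact_mod_cast this.symm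
    have h0 : (M - N).map K = 0 := by
      refine eq_zero_of_forall_eval_eq_zero h (n := N.ord) (fun i hi => ?_) (hr N hN).ge
        fun w hw => ?_
      · rw [coeff_map, hM.1.coeff_sub_eq_zero hN.1 hord hi, map_zero]
      · have h1 : N.eval w = 0 := hw
        have h2 : M.eval w = 0 := by
          rw [← hMN] at hw
          exact hw
        rw [eval_map, eval_sub_left, h1, h2, sub_zero]
    exact sub_eq_zero.mp (map_injective (h0.trans (Polynomial.map_zero (algebraMap k K)).symm))
  · have hlt := ((Submodule.rank_mono hW.1).trans (rank_solutionSpace_le (K := K) h hL)).trans_lt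
      Cardinal.natCast_lt_aleph0
    have : Module.Finite (fieldOfConstants k) W := Module.rank_lt_aleph0_iff.mp hlt
    obtain ⟨-, L₀, hL₀, -, heq⟩ := exists_map_eq_wronskianOperator h hfix hW
      (Module.finBasis (fieldOfConstants k) W)
    exact ⟨L₀, hL₀, heq⟩

/-- The equation `L(y) = 0` has a full solution space if its companion system has a fundamental
matrix. -/
theorem ord_le_rank_solutionSpace (h : NoNewConstants k K) {L : DiffOp k} (hL : L ≠ 0)
    {Y : Matrix (Fin L.ord) (Fin L.ord) K} (hY : Y.det ≠ 0)
    (hYd : Y.map (fun z => z′) = L.companion.map (algebraMap k K) * Y) :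
    (L.ord : Cardinal) ≤ Module.rank (fieldOfConstants k) (L.solutionSpace K) := by
  rcases Nat.eq_zero_or_pos L.ord with hn | hn
  · rw [hn]
    simp
  have hY' : ∀ i j, (Y i j)′ = ∑ l, algebraMap k K (L.companion i l) * Y l j := fun i j =>
    congrFun (congrFun hYd i) j
  -- The companion form makes each row of Y the derivative of the one above. Its last row then says
  -- that the entries of the first row solve L(y) = 0.
  have hit : ∀ (i : ℕ) (hi : i < L.ord) (j), (fun z : K => z′)^[i] (Y ⟨0, hn⟩ j) = Y ⟨i, hi⟩ j := by
    intro i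
    induction i with
    | zero => exact fun _ _ => rfl
    | succ i ih =>
      intro hi j
      rw [Function.iterate_succ_apply', ih (by omega), hY',
        Finset.sum_eq_single (⟨i + 1, hi⟩ : Fin L.ord)]
      · simp [companion]
      · intro l _ hl
        have h1 : i + 1 ≠ l := fun h => hl (Fin.ext h.symm)
        simp [companion, h1, hi.ne]
      · simp
  have hsol : ∀ j, Y ⟨0, hn⟩ j ∈ L.solutionSpace K := by
    intro j
    change L.eval _ = 0
    rw [eval_eq_sum (n := L.ord + 1) (fun i hi => coeff_eq_zero_of_ord_lt hi),
      Finset.sum_range_succ, Finset.sum_range]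
    simp only [fun i : Fin L.ord => hit i i.2]
    have hlast : (fun z : K => z′)^[L.ord] (Y ⟨0, hn⟩ j) =
        ∑ l : Fin L.ord, algebraMap k K (-(L.coeff l / L.coeff L.ord)) * Y l j := by
      have h0 := Function.iterate_succ_apply' (fun z : K => z′) (L.ord - 1) (Y ⟨0, hn⟩ j)
      rw [Nat.succ_eq_add_one, Nat.sub_add_cancel hn, hit (L.ord - 1) (by omega), hY'] at h0
      rw [h0]
      refine Finset.sum_congr rfl fun l _ => ?_
      have h1 : L.ord - 1 + 1 = L.ord := by omega
      have h2 : L.ord ≠ l := by omega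
      simp [companion, h1, h2]
    rw [hlast, Finset.mul_sum, ← Finset.sum_add_distrib]
    refine Finset.sum_eq_zero fun l _ => ?_
    rw [← mul_assoc, ← map_mul, mul_neg, mul_div_cancel₀ _ (coeff_ord_ne_zero hL), map_neg,
      neg_mul, add_neg_cancel]
  have hli : LinearIndependent (fieldOfConstants k) fun j => Y ⟨0, hn⟩ j := by
    rw [Fintype.linearIndependent_iff]
    intro c hc
    -- Differentiating a constant relation in the first row i times gives it in row i, so c lies in
    -- the kernel of the invertible matrix Y.
    have h0 : Y.mulVec (fun j => algebraMap (fieldOfConstants k) K (c j)) = 0 := by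
      funext i
      have := congrArg ((ofPoly (monomial (i : ℕ) (1 : k))).evalLinear h.deriv_eq_zero) hc
      rw [map_sum, map_zero] at this
      rw [Pi.zero_apply, ← this, Matrix.mulVec, dotProduct]
      refine Finset.sum_congr rfl fun j _ => ?_
      rw [map_smul, Algebra.smul_def, mul_comm]
      congr 1
      change _ = (ofPoly (monomial (i : ℕ) (1 : k))).eval _
      rw [eval_ofPoly_monomial, map_one, one_mul, hit i i.2]
    intro j
    have := congrFun (Matrix.eq_zero_of_mulVec_eq_zero hY h0) j
    exact (map_eq_zero _).mp this
  have hli' : LinearIndependent (fieldOfConstants k)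
      fun j => (⟨Y ⟨0, hn⟩ j, hsol j⟩ : L.solutionSpace K) :=
    LinearIndependent.of_comp (L.solutionSpace K).subtype hli
  simpa using hli'.cardinal_lift_le_rank

end InvariantSubspaces

end DiffOp

/-! ### The correspondence for a Picard–Vessiot field -/

theorem mainTheorem3 {k : Type*} {K : Type*}
    [Field k] [CharZero k] [Differential k] [IsAlgClosed (fieldOfConstants k)]
    [Field K] [Differential K] [Algebra k K] [DifferentialAlgebra k K]
    (L : DiffOp k) (hL : L ≠ 0) (hK : IsPVField L.companion K) :
    -- monic right factors correspond to differential submodules, via `L₀ ↦ k[∂]L₀ / k[∂]L`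
    Set.BijOn
      (fun L₀ : DiffOp k =>
        (Submodule.span (DiffOp k) {L₀}).map (Submodule.span (DiffOp k) {L}).mkQ)
      L.monicRightFactors
      (Set.univ : Set (Submodule (DiffOp k) (DiffOp k ⧸ Submodule.span (DiffOp k) {L}))) ∧
    -- monic right factors correspond to invariant subspaces, via `L₀ ↦ Soln_K(L₀(y) = 0)`
    Set.BijOn (fun L₀ : DiffOp k => L₀.solutionSpace K)
      L.monicRightFactors (L.invariantSubspaces K) ∧
    -- the dimension of the invariant subspace is the order of the right factor
    (∀ L₀ ∈ L.monicRightFactors,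
      Module.rank (fieldOfConstants k) (L₀.solutionSpace K) = (L₀.ord : Cardinal)) ∧
    -- the right factor that corresponds to an invariant subspace is its Wronskian operator
    (∀ W ∈ L.invariantSubspaces K, ∀ (t : ℕ) (b : Module.Basis (Fin t) (fieldOfConstants k) W),
      wronskianDet (fun j => (b j : K)) ≠ 0 ∧
      (∀ σ ∈ DGal k K, ∀ i : ℕ, σ ((wronskianOperator fun j => (b j : K)).coeff i) =
        (wronskianOperator fun j => (b j : K)).coeff i) ∧
      ∃ L₀ ∈ L.monicRightFactors, L₀.map K = wronskianOperator (fun j => (b j : K)) ∧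
        L₀.solutionSpace K = W) := by
  obtain ⟨R, _, _, _, _, _, _, _, _, hR⟩ := hK
  have h : DiffOp.NoNewConstants k K := hR.constants_iff
  have hfix : ∀ a : K, (∀ σ ∈ DGal k K, σ a = a) → a ∈ (algebraMap k K).range :=
    fun a ha => hR.mem_range_of_forall_mem_DGal ha
  have hrank : (L.ord : Cardinal) ≤ Module.rank (fieldOfConstants k) (L.solutionSpace K) := by
    obtain ⟨-, Z, hZ, -⟩ := hR
    exact DiffOp.ord_le_rank_solutionSpace h hL (Z.isUnit_det_map K).ne_zero (hZ.map_deriv K)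
  refine ⟨DiffOp.bijOn_span_map_mkQ hL, DiffOp.bijOn_solutionSpace h hfix hL hrank, ?_, ?_⟩
  · rintro L₀ ⟨-, L₁, rfl⟩
    exact DiffOp.rank_solutionSpace_of_mul h hL hrank
  · intro W hW t b
    exact ⟨DiffOp.wronskianDet_ne_zero h b, DiffOp.exists_map_eq_wronskianOperator h hfix hW b⟩
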